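/- Let $\Theta=\prod_{k=1}^d I_k\subset\mathbb R^d$ be an open interval (each $I_k\subset\mathbb R$ an open, possibly unbounded, interval), let $S$ be a Polish space with its Borel $\sigma$-algebra and a $\sigma$-finite measure $\nu$ (for instance $\mathbb R^q$ with Lebesgue measure), and let $p(\cdot\mid\theta)$, $\theta\in\Theta$, be strictly positive measurable probability densities with respect to $\nu$. Assume: (1) for all $\theta\in\Theta$ and $x\in S$ the gradient (all partial derivatives) $s(x,\theta)=\nabla_\theta\log p(x\mid\theta)$ exists; (2) every point of the closure $\overline\Theta$ has a neighbourhood $U$ and a $\nu$-integrable function $g$ with $|\partial p(x\mid\theta)/\partial\theta_k|\le g(x)$ for all $x$, all $\theta\in U\cap\Theta$ and all $k$ (for instance a single integrable $g$ serves for all $\theta\in\Theta$); (3) for $X\sim p(\cdot\mid\theta)$ the Fisher information $I(\theta)=E_\theta[s(X,\theta)s(X,\theta)^{\top}]$ exists (is finite) for each $\theta\in\Theta$, and the step sizes $\epsilon_m\in\mathbb R^d$ satisfy one of (3a) $0<\operatorname{tr} I(\theta)\le R$ on $\Theta$ for some constant $R>0$, and the $\epsilon_m$ are deterministic with $\sum_m\epsilon_{m,k}^2<\infty$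 for every $k$ (for instance $\epsilon_{m,k}=1/m$); or (3b) $\epsilon_{m,k}=\tau_{m,k}/\sqrt{I(\theta_m)_{kk}}$ (read as $0$ where $I(\theta_m)_{kk}=0$) with deterministic $\tau_{m,k}$, $\sum_m\tau_{m,k}^2<\infty$ for every $k$. Let $n\in\mathbb N$, and let $\theta_n$ be a $\Theta$-valued initial value which may be random and is known at time $n$. For $m\ge n$ let, given the past $\mathcal F_m$ (a filtration to which the $\theta_m$, $m\ge n$, and the $X_m$, $m>n$, are adapted), $$X_{m+1}\sim p(\cdot\mid\theta_m),\qquad \theta_{m+1,k}=\theta_{m,k}+\epsilon_{m,k}\,s_k(X_{m+1},\theta_m),\quad k=1,\dots,d,$$ where $\theta_m\in\Theta$ almost surely for all $m\ge n$, so that the scheme is defined. Then: (i) For every $\theta\in\overline\Theta$ the limit $\bar p(x\mid\theta)=\lim_{\Theta\ni\vartheta\to\theta}p(x\mid\vartheta)$ exists for all $x$; $\bar p(\cdot\mid\theta)$ is a probability density with respect to $\nu$, and $\bar p(\cdot\mid\theta)=p(\cdot\mid\theta)$ for $\theta\in\Theta$. (We write $p(\cdot\mid\theta)$ for $\bar p(\cdot\mid\theta)$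 also at boundary points.) (ii) There is a random vector $\theta_\infty$ with values in $\overline\Theta$ almost surely such that $\theta_m\to\theta_\infty$ almost surely, and the laws $\mathcal P_m$ of $\theta_m$ converge weakly to the law $\mathcal P_\infty$ of $\theta_\infty$. (iii) The sequence $(X_m)_{m>n}$ is asymptotically exchangeable: there is, on some probability space, an exchangeable sequence $(Z_1,Z_2,\dots)$ such that, as $m\to\infty$, $$(X_{m+1},X_{m+2},\dots)\to_d(Z_1,Z_2,\dots)$$ (weak convergence of laws on $S^{\mathbb N}$ with the product topology), and there is a random vector $\theta\sim\mathcal P_\infty$ on the same probability space such that, conditionally on $\theta$, the $Z_i$ are i.i.d. from $p(\cdot\mid\theta)$. -/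

import Mathlib

open MeasureTheory ProbabilityTheory Filter Topology

universe u v

noncomputable section

namespace ScoreMartingale

/-- The parameter space: the open interval (box) `∏ k, I k` in `ℝ^d`. -/
def paramSpace {d : ℕ} (I : Fin d → Set ℝ) : Set (Fin d → ℝ) :=
  {θ | ∀ k, θ k ∈ I k}

/-- The probability law with density `p (· ∣ θ)`, written `p θ`, with respect to `ν`. -/
def modelLaw {d : ℕ} {S : Type u} [MeasurableSpace S] (p : (Fin d → ℝ) → S → ℝ)
    (ν : Measure S) (θ : Fin d → ℝ) : Measure S :=
  ν.withDensity fun x => ENNReal.ofReal (p θ x)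

/-- The density extended by continuity in the parameter from `Θ` to its closure:
`p̄ (x ∣ θ) = lim p (x ∣ ϑ)` as `ϑ → θ` within `Θ`. -/
def extendedDensity {d : ℕ} {S : Type u} (Θ : Set (Fin d → ℝ)) (p : (Fin d → ℝ) → S → ℝ)
    (θ : Fin d → ℝ) (x : S) : ℝ :=
  extendFrom Θ (fun ϑ => p ϑ x) θ

/-- The score function `s (x, θ) = ∇_θ log p (x ∣ θ)`, through its coordinates. -/
def score {d : ℕ} {S : Type u} (p : (Fin d → ℝ) → S → ℝ) (x : S) (θ : Fin d → ℝ) :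
    Fin d → ℝ :=
  fun k => lineDeriv ℝ (fun ϑ => Real.log (p ϑ x)) θ (Pi.single k 1)

/-- The Fisher information matrix `E_θ [s (X, θ) s (X, θ)ᵀ]`. -/
def fisherInfo {d : ℕ} {S : Type u} [MeasurableSpace S] (p : (Fin d → ℝ) → S → ℝ)
    (ν : Measure S) (θ : Fin d → ℝ) : Matrix (Fin d) (Fin d) ℝ :=
  Matrix.of fun j k => ∫ x, score p x θ j * score p x θ k ∂(modelLaw p ν θ)

/-- A statistical model on an open interval `Θ = ∏ k, I k` of `ℝ^d` with positive densities
`p (· ∣ θ)`, for which the gradient of `log p` in `θ` exists and the partial derivatives of `p`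
in `θ` are dominated, near every point of the closure of `Θ`, by an integrable function
(for instance by one and the same integrable function on all of `Θ`). -/
structure IsRegularModel {d : ℕ} {S : Type u} [MeasurableSpace S] (I : Fin d → Set ℝ)
    (p : (Fin d → ℝ) → S → ℝ) (ν : Measure S) : Prop where
  isOpen : ∀ k, IsOpen (I k)
  ordConnected : ∀ k, (I k).OrdConnected
  measurable : ∀ θ ∈ paramSpace I, Measurable (p θ)
  pos : ∀ θ ∈ paramSpace I, ∀ x, 0 < p θ x
  isProbability : ∀ θ ∈ paramSpace I, IsProbabilityMeasure (modelLaw p ν θ)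
  gradient_exists : ∀ θ ∈ paramSpace I, ∀ x, ∀ k,
    LineDifferentiableAt ℝ (fun ϑ => Real.log (p ϑ x)) θ (Pi.single k 1)
  dominated : ∀ θ₀ ∈ closure (paramSpace I), ∃ U ∈ 𝓝 θ₀, ∃ g : S → ℝ, Integrable g ν ∧
    ∀ θ ∈ U ∩ paramSpace I, ∀ x, ∀ k,
      |lineDeriv ℝ (fun ϑ => p ϑ x) θ (Pi.single k 1)| ≤ g x

/-- The Fisher information exists (is finite) at every parameter. -/
def HasFisherInfo {d : ℕ} {S : Type u} [MeasurableSpace S] (I : Fin d → Set ℝ)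
    (p : (Fin d → ℝ) → S → ℝ) (ν : Measure S) : Prop :=
  ∀ θ ∈ paramSpace I, ∀ k, Integrable (fun x => score p x θ k ^ 2) (modelLaw p ν θ)

/-- First step-size regime: the trace of the Fisher information is bounded, and the steps are
deterministic and square summable (for instance `ε m k = 1 / m`). -/
def BoundedInfoSteps {d : ℕ} {S : Type u} [MeasurableSpace S] (I : Fin d → Set ℝ)
    (p : (Fin d → ℝ) → S → ℝ) (ν : Measure S) (n : ℕ)
    (ε : ℕ → (Fin d → ℝ) → Fin d → ℝ) : Prop :=
  (∃ R > 0, ∀ θ ∈ paramSpace I,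
    0 < (fisherInfo p ν θ).trace ∧ (fisherInfo p ν θ).trace ≤ R) ∧
  ∃ e : ℕ → Fin d → ℝ, (∀ k, Summable fun m => e m k ^ 2) ∧
    ∀ m ≥ n, ∀ θ ∈ paramSpace I, ∀ k, ε m θ k = e m k

/-- Second step-size regime: `ε m k = τ m k / √(D θ k)` with `τ` square summable, where `D θ` is
the diagonal of the Fisher information (the quotient being `0` where `D θ k = 0`). -/
def ScaledSteps {d : ℕ} {S : Type u} [MeasurableSpace S] (I : Fin d → Set ℝ)
    (p : (Fin d → ℝ) → S → ℝ) (ν : Measure S) (n : ℕ)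
    (ε : ℕ → (Fin d → ℝ) → Fin d → ℝ) : Prop :=
  ∃ τ : ℕ → Fin d → ℝ, (∀ k, Summable fun m => τ m k ^ 2) ∧
    ∀ m ≥ n, ∀ θ ∈ paramSpace I, ∀ k, ε m θ k = τ m k / √(fisherInfo p ν θ k k)

/-- The score-driven scheme started at time `n`: for every `m ≥ n`, given the past `ℱ m`,
the observation `X (m + 1)` is drawn from `p (· ∣ θ m)`, and then
`θ (m + 1) = θ m + ε m ⊗ s (X (m + 1), θ m)`, coordinate by coordinate. The parameters remain in
`Θ`, which is what gives the scheme a meaning. -/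
structure IsScoreScheme {d : ℕ} {S : Type u} [MeasurableSpace S] (I : Fin d → Set ℝ)
    (p : (Fin d → ℝ) → S → ℝ) (ν : Measure S) (n : ℕ) (ε : ℕ → (Fin d → ℝ) → Fin d → ℝ)
    {Ω : Type v} [mΩ : MeasurableSpace Ω] (μ : Measure Ω) (ℱ : Filtration ℕ mΩ)
    (X : ℕ → Ω → S) (θ : ℕ → Ω → Fin d → ℝ) : Prop where
  measurable_param : ∀ m ≥ n, Measurable[ℱ m] (θ m)
  measurable_obs : ∀ m ≥ n, Measurable[ℱ (m + 1)] (X (m + 1))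
  mem_paramSpace : ∀ m ≥ n, ∀ᵐ ω ∂μ, θ m ω ∈ paramSpace I
  sampling : ∀ m ≥ n, ∀ A : Set S, MeasurableSet A →
    μ[(X (m + 1) ⁻¹' A).indicator (fun _ => (1 : ℝ)) | ℱ m]
      =ᵐ[μ] fun ω => (modelLaw p ν (θ m ω)).real A
  update : ∀ m ≥ n, ∀ᵐ ω ∂μ, ∀ k,
    θ (m + 1) ω k = θ m ω k + ε m (θ m ω) k * score p (X (m + 1) ω) (θ m ω) k

/-- A sequence of random variables is exchangeable if the joint law of its first `k` terms is
invariant under permutations, for every `k`. -/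
def Exchangeable {S : Type u} [MeasurableSpace S] {Ω : Type v} [MeasurableSpace Ω]
    (P : Measure Ω) (Z : ℕ → Ω → S) : Prop :=
  ∀ (k : ℕ) (σ : Equiv.Perm (Fin k)),
    P.map (fun ω (i : Fin k) => Z (σ i) ω) = P.map (fun ω (i : Fin k) => Z i ω)

/-- Conditionally on `ϑ`, the variables `Z i` are i.i.d. with law `κ ϑ`. -/
def CondIID {d : ℕ} {S : Type u} [MeasurableSpace S] {Ω : Type v} [MeasurableSpace Ω]
    (P : Measure Ω) (κ : (Fin d → ℝ) → Measure S) (ϑ : Ω → Fin d → ℝ) (Z : ℕ → Ω → S) : Prop :=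
  ∀ (s : Finset ℕ) (A : ℕ → Set S), (∀ i, MeasurableSet (A i)) →
    P[(⋂ i ∈ s, Z i ⁻¹' A i).indicator (fun _ => (1 : ℝ)) |
        MeasurableSpace.comap ϑ inferInstance]
      =ᵐ[P] fun ω => ∏ i ∈ s, (κ (ϑ ω)).real (A i)

end ScoreMartingale

end

/-! Three facts carry the result.

Regularity. The dominated partial derivatives make `p` locally Lipschitz in the parameter, with an
integrable constant, near every point of the closure of `Θ` (`IsRegularModel.exists_lipschitz`).
Hence `p` extends continuously to the closure, and dominated convergence shows that the model laws
converge setwise, also at the boundary (`IsRegularModel.tendsto_modelLaw`). Differentiating the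
total mass under the integral gives the score mean zero (`IsRegularModel.integral_score`).

Martingale. Each coordinate of `θ m` therefore moves by martingale differences whose conditional
variance is the squared step times a diagonal entry of the Fisher information. Either step regime
bounds this by a summable deterministic sequence, so the partial sums are bounded in L² and converge
almost surely (`ae_exists_tendsto_sum_range`).

Mixture. Once the parameter has nearly settled, successive observations are nearly independent draws
from one law. Conditioning on the past one observation at a time shows that probabilities of
measurable rectangles converge to those of a mixture of i.i.d. laws, mixed by the law of the limit
(`tendsto_measureReal_iInter`). Rectangles determine weak convergence on `S^ℕ`, and such a mixture
is exchangeable. -/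

namespace ScoreMartingale

/-! ### Regularity of the model: extension to the closure, Markov kernel, mean-zero score -/

section Model

variable {d : ℕ} {S : Type u} [MeasurableSpace S] {I : Fin d → Set ℝ}
  {p : (Fin d → ℝ) → S → ℝ} {ν : Measure S}

theorem IsRegularModel.isOpen_paramSpace (hp : IsRegularModel I p ν) :
    IsOpen (paramSpace I) := by
  have h : paramSpace I = Set.univ.pi I := by ext; simp [paramSpace]
  rw [h]
  exact isOpen_set_pi Set.finite_univ fun k _ => hp.isOpen k

theorem hasDerivAt_update_of_hasLineDerivAt {f : (Fin d → ℝ) → ℝ} {η : Fin d → ℝ} {k : Fin d}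
    {t f' : ℝ} (h : HasLineDerivAt ℝ f f' (Function.update η k t) (Pi.single k 1)) :
    HasDerivAt (fun u => f (Function.update η k u)) f' t := by
  have h1 : HasDerivAt (fun u => f (Function.update η k t + (u - t) • Pi.single k (1 : ℝ))) f' t := by
    have h2 : HasDerivAt (fun u => f (Function.update η k t + u • Pi.single k (1 : ℝ))) f'
      (t - t) := by rw [sub_self]; exact h
    simpa using HasDerivAt.comp_sub_const t t h2
  refine h1.congr_of_eventuallyEq (Eventually.of_forall fun u => ?_)
  dsimp only
  congr 1
  ext i
  by_cases hi : i = k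
  · subst hi; simp
  · simp [hi]

theorem hasDerivAt_line_of_hasLineDerivAt {f : (Fin d → ℝ) → ℝ} {η v : Fin d → ℝ}
    {t f' : ℝ} (h : HasLineDerivAt ℝ f f' (η + t • v) v) :
    HasDerivAt (fun u : ℝ => f (η + u • v)) f' t := by
  have h2 : HasDerivAt (fun u : ℝ => f (η + t • v + u • v)) f' (t - t) := by
    rw [sub_self]; exact h
  refine (HasDerivAt.comp_sub_const t t h2).congr_of_eventuallyEq
    (Eventually.of_forall fun u => ?_)
  dsimp only
  congr 1
  rw [sub_smul]
  abel

theorem tendsto_line (θ v : Fin d → ℝ) :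
    Tendsto (fun t : ℝ => θ + t • v) (𝓝 0) (𝓝 θ) := by
  have h : Continuous fun t : ℝ => θ + t • v := by fun_prop
  simpa using h.tendsto 0

theorem IsRegularModel.hasLineDerivAt_log (hp : IsRegularModel I p ν) {θ : Fin d → ℝ}
    (hθ : θ ∈ paramSpace I) (x : S) (k : Fin d) :
    HasLineDerivAt ℝ (fun ϑ => Real.log (p ϑ x)) (score p x θ k) θ (Pi.single k 1) :=
  (hp.gradient_exists θ hθ x k).hasLineDerivAt

theorem IsRegularModel.hasLineDerivAt (hp : IsRegularModel I p ν) {θ : Fin d → ℝ}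
    (hθ : θ ∈ paramSpace I) (x : S) (k : Fin d) :
    HasLineDerivAt ℝ (fun ϑ => p ϑ x) (p θ x * score p x θ k) θ (Pi.single k 1) := by
  have h : HasDerivAt (fun t : ℝ => Real.log (p (θ + t • Pi.single k 1) x))
    (score p x θ k) 0 := hp.hasLineDerivAt_log hθ x k
  have h1 := h.exp
  simp only [zero_smul, add_zero, Real.exp_log (hp.pos θ hθ x)] at h1
  refine h1.congr_of_eventuallyEq ?_
  filter_upwards [(tendsto_line θ (Pi.single k 1)).eventually
    (hp.isOpen_paramSpace.mem_nhds hθ)] with t ht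
  rw [Real.exp_log (hp.pos _ ht x)]

theorem IsRegularModel.lineDeriv_eq (hp : IsRegularModel I p ν) {θ : Fin d → ℝ}
    (hθ : θ ∈ paramSpace I) (x : S) (k : Fin d) :
    lineDeriv ℝ (fun ϑ => p ϑ x) θ (Pi.single k 1) = p θ x * score p x θ k :=
  (hp.hasLineDerivAt hθ x k).lineDeriv

theorem IsRegularModel.abs_update_sub_le (hp : IsRegularModel I p ν) {θ₀ : Fin d → ℝ} {r : ℝ}
    {g : S → ℝ} (hg : ∀ θ ∈ Metric.ball θ₀ r ∩ paramSpace I, ∀ x, ∀ k,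
      |lineDeriv ℝ (fun ϑ => p ϑ x) θ (Pi.single k 1)| ≤ g x)
    {η : Fin d → ℝ} (hη : η ∈ Metric.ball θ₀ r ∩ paramSpace I) {k : Fin d} {a : ℝ}
    (ha : Function.update η k a ∈ Metric.ball θ₀ r ∩ paramSpace I) (x : S) :
    |p (Function.update η k a) x - p η x| ≤ g x * |a - η k| := by
  have hr : 0 < r := dist_nonneg.trans_lt hη.1
  have key : ∀ t ∈ Set.uIcc (η k) a,
      Function.update η k t ∈ Metric.ball θ₀ r ∩ paramSpace I := by
    intro t ht
    constructor
    · have h1 := hη.1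
      have h2 := ha.1
      rw [Metric.mem_ball, dist_pi_lt_iff hr] at h1 h2 ⊢
      intro i
      by_cases hi : i = k
      · subst hi
        have h3 := h2 i
        simp only [Function.update_self] at h3 ⊢
        have hc := (convex_ball (θ₀ i) r).ordConnected
        exact hc.uIcc_subset (h1 i) h3 ht
      · simpa [hi] using h1 i
    · intro i
      by_cases hi : i = k
      · subst hi
        have h3 := ha.2 i
        simp only [Function.update_self] at h3 ⊢
        exact (hp.ordConnected i).uIcc_subset (hη.2 i) h3 ht
      · simpa [hi] using hη.2 i
  have h := (convex_uIcc (η k) a).norm_image_sub_le_of_norm_hasDerivWithin_le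
    (f := fun t => p (Function.update η k t) x)
    (f' := fun t => lineDeriv ℝ (fun ϑ => p ϑ x) (Function.update η k t) (Pi.single k 1))
    (C := g x)
    (fun t ht => (hasDerivAt_update_of_hasLineDerivAt
      (hp.hasLineDerivAt (key t ht).2 x k).lineDifferentiableAt.hasLineDerivAt).hasDerivWithinAt)
    (fun t ht => hg _ (key t ht) x k) Set.left_mem_uIcc Set.right_mem_uIcc
  simpa using h

/-- Only partial derivatives are available, so `θ'` is turned into `θ` one coordinate at a time,
with the mean value inequality at each move. The sup-norm ball and the box are products, hence
contain every intermediate point; the factor `d` counts the moves. -/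
theorem IsRegularModel.abs_sub_le (hp : IsRegularModel I p ν) {θ₀ : Fin d → ℝ} {r : ℝ}
    {g : S → ℝ} (hg : ∀ θ ∈ Metric.ball θ₀ r ∩ paramSpace I, ∀ x, ∀ k,
      |lineDeriv ℝ (fun ϑ => p ϑ x) θ (Pi.single k 1)| ≤ g x) (hg0 : ∀ x, 0 ≤ g x)
    {θ θ' : Fin d → ℝ} (hθ : θ ∈ Metric.ball θ₀ r ∩ paramSpace I)
    (hθ' : θ' ∈ Metric.ball θ₀ r ∩ paramSpace I) (x : S) :
    |p θ x - p θ' x| ≤ d * g x * dist θ θ' := by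
  classical
  have hr : 0 < r := dist_nonneg.trans_lt hθ.1
  have hmem : ∀ s : Finset (Fin d), s.piecewise θ θ' ∈ Metric.ball θ₀ r ∩ paramSpace I := by
    intro s
    constructor
    · have h1 := hθ.1
      have h2 := hθ'.1
      rw [Metric.mem_ball, dist_pi_lt_iff hr] at h1 h2 ⊢
      intro i
      by_cases hi : i ∈ s
      · simpa [hi] using h1 i
      · simpa [hi] using h2 i
    · intro i
      by_cases hi : i ∈ s
      · simpa [hi] using hθ.2 i
      · simpa [hi] using hθ'.2 i
  have key : ∀ s : Finset (Fin d),
      |p (s.piecewise θ θ') x - p θ' x| ≤ s.card * g x * dist θ θ' := by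
    intro s
    induction s using Finset.induction_on with
    | empty => simp
    | insert k s hk ih =>
      have h1 := hp.abs_update_sub_le hg (hmem s) (k := k) (a := θ k)
        (by rw [← Finset.piecewise_insert]; exact hmem _) x
      rw [← Finset.piecewise_insert] at h1
      have h2 : |θ k - s.piecewise θ θ' k| ≤ dist θ θ' := by
        rw [Finset.piecewise_eq_of_notMem _ _ _ hk]
        exact dist_le_pi_dist θ θ' k
      have h3 := mul_le_mul_of_nonneg_left h2 (hg0 x)
      rw [Finset.card_insert_of_notMem hk]
      push_cast
      calc |p ((insert k s).piecewise θ θ') x - p θ' x|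
          ≤ |p ((insert k s).piecewise θ θ') x - p (s.piecewise θ θ') x|
            + |p (s.piecewise θ θ') x - p θ' x| := _root_.abs_sub_le _ _ _
        _ ≤ g x * dist θ θ' + s.card * g x * dist θ θ' := by gcongr; exact h1.trans h3
        _ = _ := by ring
  simpa using key Finset.univ

/-- Near every point of the closure of the parameter space the density is Lipschitz in the
parameter, with an integrable Lipschitz constant. -/
theorem IsRegularModel.exists_lipschitz (hp : IsRegularModel I p ν) {θ₀ : Fin d → ℝ}
    (hθ₀ : θ₀ ∈ closure (paramSpace I)) :
    ∃ r > 0, ∃ g : S → ℝ, Integrable g ν ∧ (∀ x, 0 ≤ g x) ∧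
      ∀ θ ∈ Metric.ball θ₀ r ∩ paramSpace I, ∀ θ' ∈ Metric.ball θ₀ r ∩ paramSpace I, ∀ x,
        |p θ x - p θ' x| ≤ g x * dist θ θ' := by
  obtain ⟨U, hU, g, hgi, hg⟩ := hp.dominated θ₀ hθ₀
  obtain ⟨r, hr, hrU⟩ := Metric.mem_nhds_iff.1 hU
  refine ⟨r, hr, fun x => d * |g x|, hgi.abs.const_mul _, fun x => by positivity, ?_⟩
  intro θ hθ θ' hθ' x
  exact hp.abs_sub_le (g := fun x => |g x|)
    (fun ϑ hϑ x k => (hg ϑ ⟨hrU hϑ.1, hϑ.2⟩ x k).trans (le_abs_self _))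
    (fun x => abs_nonneg _) hθ hθ' x

/-- A real Lipschitz function on a subset extends to a Lipschitz function on the whole space, and
the value of the extension at `θ₀` is the limit. -/
theorem IsRegularModel.exists_tendsto (hp : IsRegularModel I p ν) {θ₀ : Fin d → ℝ}
    (hθ₀ : θ₀ ∈ closure (paramSpace I)) (x : S) :
    ∃ y, Tendsto (fun ϑ => p ϑ x) (𝓝[paramSpace I] θ₀) (𝓝 y) := by
  obtain ⟨r, hr, g, -, hg0, hL⟩ := hp.exists_lipschitz hθ₀
  have hlip : LipschitzOnWith ⟨g x, hg0 x⟩ (fun ϑ => p ϑ x) (Metric.ball θ₀ r ∩ paramSpace I) :=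
    LipschitzOnWith.of_dist_le_mul fun θ hθ θ' hθ' => hL θ hθ θ' hθ' x
  obtain ⟨f, hf, hfe⟩ := hlip.extend_real
  refine ⟨f θ₀, ((hf.continuous.tendsto θ₀).mono_left nhdsWithin_le_nhds).congr' ?_⟩
  filter_upwards [self_mem_nhdsWithin, mem_nhdsWithin_of_mem_nhds (Metric.ball_mem_nhds θ₀ hr)]
    with θ h1 h2
  exact (hfe ⟨h2, h1⟩).symm

theorem IsRegularModel.tendsto_extendedDensity (hp : IsRegularModel I p ν) {θ₀ : Fin d → ℝ}
    (hθ₀ : θ₀ ∈ closure (paramSpace I)) (x : S) :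
    Tendsto (fun ϑ => p ϑ x) (𝓝[paramSpace I] θ₀)
      (𝓝 (extendedDensity (paramSpace I) p θ₀ x)) :=
  tendsto_extendFrom (hp.exists_tendsto hθ₀ x)

theorem IsRegularModel.extendedDensity_eq (hp : IsRegularModel I p ν) {θ : Fin d → ℝ}
    (hθ : θ ∈ paramSpace I) : extendedDensity (paramSpace I) p θ = p θ := by
  funext x
  have h := hp.tendsto_extendedDensity (subset_closure hθ) x
  exact tendsto_nhds_unique (tendsto_pure_nhds (fun ϑ => p ϑ x) θ)
    (h.mono_left (pure_le_nhdsWithin hθ)) |>.symm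

theorem IsRegularModel.continuousOn_extendedDensity (hp : IsRegularModel I p ν) (x : S) :
    ContinuousOn (fun θ => extendedDensity (paramSpace I) p θ x) (closure (paramSpace I)) :=
  continuousOn_extendFrom le_rfl fun _ hθ => hp.exists_tendsto hθ x

theorem IsRegularModel.measurable_extendedDensity (hp : IsRegularModel I p ν) {θ : Fin d → ℝ}
    (hθ : θ ∈ closure (paramSpace I)) : Measurable (extendedDensity (paramSpace I) p θ) := by
  obtain ⟨u, hu, hut⟩ := mem_closure_iff_seq_limit.1 hθ
  have h : Tendsto u atTop (𝓝[paramSpace I] θ) :=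
    tendsto_nhdsWithin_iff.2 ⟨hut, Eventually.of_forall hu⟩
  exact measurable_of_tendsto_metrizable (fun n => hp.measurable _ (hu n))
    (tendsto_pi_nhds.2 fun x => (hp.tendsto_extendedDensity hθ x).comp h)

theorem IsRegularModel.integrable (hp : IsRegularModel I p ν) {θ : Fin d → ℝ}
    (hθ : θ ∈ paramSpace I) : Integrable (p θ) ν := by
  refine ⟨(hp.measurable θ hθ).aestronglyMeasurable, ?_⟩
  have h := (hp.isProbability θ hθ).measure_univ
  rw [modelLaw, withDensity_apply _ .univ, Measure.restrict_univ] at h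
  rw [HasFiniteIntegral]
  have : ∀ x, ‖p θ x‖ₑ = ENNReal.ofReal (p θ x) := fun x => by
    rw [← Real.enorm_of_nonneg (hp.pos θ hθ x).le]
  simp [this, h]

theorem IsRegularModel.integral_eq_one (hp : IsRegularModel I p ν) {θ : Fin d → ℝ}
    (hθ : θ ∈ paramSpace I) : ∫ x, p θ x ∂ν = 1 := by
  rw [integral_eq_lintegral_of_nonneg_ae (Eventually.of_forall fun x => (hp.pos θ hθ x).le)
    (hp.measurable θ hθ).aestronglyMeasurable]
  have h := (hp.isProbability θ hθ).measure_univ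
  rw [modelLaw, withDensity_apply _ .univ, Measure.restrict_univ] at h
  simp [h]

/-- The model laws converge setwise at every point of the closure of the parameter space. -/
theorem IsRegularModel.tendsto_modelLaw (hp : IsRegularModel I p ν) {θ₀ : Fin d → ℝ}
    (hθ₀ : θ₀ ∈ closure (paramSpace I)) {A : Set S} (hA : MeasurableSet A) :
    Tendsto (fun θ => modelLaw p ν θ A) (𝓝[paramSpace I] θ₀)
      (𝓝 (modelLaw (extendedDensity (paramSpace I) p) ν θ₀ A)) := by
  obtain ⟨r, hr, g, hgi, hg0, hL⟩ := hp.exists_lipschitz hθ₀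
  -- An interior reference point `θ₁` supplies the dominating function; the `2 * r` below is the
  -- distance bound for two points of the ball.
  obtain ⟨θ₁, hθ₁, hd⟩ := Metric.mem_closure_iff.1 hθ₀ r hr
  have h1 : θ₁ ∈ Metric.ball θ₀ r ∩ paramSpace I := ⟨by rwa [Metric.mem_ball'], hθ₁⟩
  simp only [modelLaw, withDensity_apply _ hA]
  have hb : Integrable (fun x => p θ₁ x + g x * (2 * r)) (ν.restrict A) :=
    ((hp.integrable hθ₁).add (hgi.mul_const _)).restrict
  refine tendsto_lintegral_filter_of_dominated_convergence
    (fun x => ENNReal.ofReal (p θ₁ x + g x * (2 * r))) ?_ ?_ ?_ ?_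
  · filter_upwards [self_mem_nhdsWithin] with θ hθ
    exact (hp.measurable θ hθ).ennreal_ofReal
  · filter_upwards [self_mem_nhdsWithin,
      mem_nhdsWithin_of_mem_nhds (Metric.ball_mem_nhds θ₀ hr)] with θ hθ hθr
    refine Eventually.of_forall fun x => ENNReal.ofReal_le_ofReal ?_
    have h2 := hL θ ⟨hθr, hθ⟩ θ₁ h1 x
    have h3 : dist θ θ₁ ≤ 2 * r := by
      have := dist_triangle_right θ θ₁ θ₀
      have h4 := h1.1
      rw [Metric.mem_ball] at hθr h4
      linarith
    have h5 := mul_le_mul_of_nonneg_left h3 (hg0 x)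
    linarith [le_abs_self (p θ x - p θ₁ x)]
  · exact hb.lintegral_lt_top.ne
  · refine Eventually.of_forall fun x => ?_
    exact ENNReal.tendsto_ofReal (hp.tendsto_extendedDensity hθ₀ x)

theorem IsRegularModel.isProbabilityMeasure_extended (hp : IsRegularModel I p ν)
    {θ₀ : Fin d → ℝ} (hθ₀ : θ₀ ∈ closure (paramSpace I)) :
    IsProbabilityMeasure (modelLaw (extendedDensity (paramSpace I) p) ν θ₀) := by
  have : (𝓝[paramSpace I] θ₀).NeBot := mem_closure_iff_nhdsWithin_neBot.1 hθ₀
  refine ⟨tendsto_nhds_unique (hp.tendsto_modelLaw hθ₀ .univ) (tendsto_const_nhds.congr' ?_)⟩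
  filter_upwards [self_mem_nhdsWithin] with θ hθ
  exact (hp.isProbability θ hθ).measure_univ.symm

theorem IsRegularModel.modelLaw_extended (hp : IsRegularModel I p ν) {θ : Fin d → ℝ}
    (hθ : θ ∈ paramSpace I) :
    modelLaw (extendedDensity (paramSpace I) p) ν θ = modelLaw p ν θ := by
  simp only [modelLaw, hp.extendedDensity_eq hθ]

open Classical in
/-- A jointly measurable version of the extended density, equal to `p θ₁` off the closure of the
parameter space. -/
theorem IsRegularModel.measurable_ite_extendedDensity (hp : IsRegularModel I p ν)
    {θ₁ : Fin d → ℝ} (hθ₁ : θ₁ ∈ paramSpace I) :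
    Measurable fun z : (Fin d → ℝ) × S =>
      if z.1 ∈ closure (paramSpace I) then extendedDensity (paramSpace I) p z.1 z.2
      else p θ₁ z.2 := by
  have hs : MeasurableSet {z : (Fin d → ℝ) × S | z.1 ∈ closure (paramSpace I)} :=
    measurable_fst isClosed_closure.measurableSet
  refine measurable_of_restrict_of_restrict_compl hs ?_ ?_
  -- On the closure the extended density is a Carathéodory function: continuous in the parameter,
  -- measurable in the observation.
  · have h := measurable_uncurry_of_continuous_of_measurable
      (u := fun (θ : closure (paramSpace I)) (x : S) => extendedDensity (paramSpace I) p θ x)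
      (fun x => (hp.continuousOn_extendedDensity x).domRestrict)
      (fun θ => hp.measurable_extendedDensity θ.2)
    have h2 : Measurable fun z : {z : (Fin d → ℝ) × S | z.1 ∈ closure (paramSpace I)} =>
        ((⟨z.1.1, z.2⟩ : closure (paramSpace I)), z.1.2) := by fun_prop
    convert h.comp h2 using 1
    ext z
    have hz : z.1.1 ∈ closure (paramSpace I) := z.2
    simp [hz]
  · convert (hp.measurable θ₁ hθ₁).comp (measurable_snd.comp measurable_subtype_coe) using 1
    ext z
    have hz : z.1.1 ∉ closure (paramSpace I) := z.2
    simp [hz]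

/-- The model laws on the closure of the parameter space form a Markov kernel. -/
theorem IsRegularModel.exists_kernel [SigmaFinite ν] (hp : IsRegularModel I p ν)
    (hne : (paramSpace I).Nonempty) :
    ∃ κ : Kernel (Fin d → ℝ) S, IsMarkovKernel κ ∧ ∀ θ ∈ closure (paramSpace I),
      κ θ = modelLaw (extendedDensity (paramSpace I) p) ν θ := by
  classical
  obtain ⟨θ₁, hθ₁⟩ := hne
  have hm := (hp.measurable_ite_extendedDensity hθ₁).ennreal_ofReal
  -- The fallback density `p θ₁` off the closure makes every value of the kernel a probability
  -- measure.
  set q : (Fin d → ℝ) → S → ENNReal := fun θ x => ENNReal.ofReal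
    (if θ ∈ closure (paramSpace I) then extendedDensity (paramSpace I) p θ x else p θ₁ x)
  have hq : Measurable (Function.uncurry q) := hm
  have hκ : ∀ θ, (Kernel.const (Fin d → ℝ) ν).withDensity q θ = ν.withDensity (q θ) := fun θ => by
    rw [Kernel.withDensity_apply _ hq, Kernel.const_apply]
  have h1 : ∀ θ ∈ closure (paramSpace I),
      ν.withDensity (q θ) = modelLaw (extendedDensity (paramSpace I) p) ν θ := by
    intro θ hθ
    simp only [q, hθ, if_true, modelLaw]
  refine ⟨(Kernel.const (Fin d → ℝ) ν).withDensity q, ⟨fun θ => ?_⟩, fun θ hθ => ?_⟩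
  · rw [hκ]
    by_cases hθ : θ ∈ closure (paramSpace I)
    · rw [h1 θ hθ]
      exact hp.isProbabilityMeasure_extended hθ
    · simp only [q, hθ, if_false]
      exact hp.isProbability θ₁ hθ₁
  · rw [hκ, h1 θ hθ]

open Classical in
/-- The score, set to zero off the parameter space, is jointly measurable. -/
theorem IsRegularModel.measurable_ite_score (hp : IsRegularModel I p ν) (k : Fin d) :
    Measurable fun z : (Fin d → ℝ) × S =>
      if z.1 ∈ paramSpace I then score p z.2 z.1 k else 0 := by
  rcases (paramSpace I).eq_empty_or_nonempty with he | ⟨θ₁, hθ₁⟩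
  · simp only [he, Set.mem_empty_iff_false, if_false]
    exact measurable_const
  have hΘ := hp.isOpen_paramSpace
  -- The score is a limit of difference quotients of `log p`. They are formed with `q`, which is
  -- jointly measurable on the whole space and agrees with `p` on `Θ`; since `Θ` is open, the
  -- shifted parameter eventually lies in it.
  set q : (Fin d → ℝ) × S → ℝ := fun z =>
    if z.1 ∈ closure (paramSpace I) then extendedDensity (paramSpace I) p z.1 z.2 else p θ₁ z.2
    with hqdef
  have hq : Measurable q := hp.measurable_ite_extendedDensity hθ₁
  have hqp : ∀ θ ∈ paramSpace I, ∀ x, q (θ, x) = p θ x := fun θ hθ x => by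
    simp [hqdef, subset_closure hθ, hp.extendedDensity_eq hθ]
  have hs : MeasurableSet {z : (Fin d → ℝ) × S | z.1 ∈ paramSpace I} :=
    measurable_fst hΘ.measurableSet
  set t : ℕ → ℝ := fun j => 1 / ((j : ℝ) + 1) with ht
  have ht0 : Tendsto t atTop (𝓝[≠] 0) := by
    refine tendsto_nhdsWithin_iff.2 ⟨tendsto_one_div_add_atTop_nhds_zero_nat,
      Eventually.of_forall fun j => ?_⟩
    simp only [ht, Set.mem_compl_iff, Set.mem_singleton_iff]
    positivity
  refine measurable_of_tendsto_metrizable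
    (f := fun (j : ℕ) (z : (Fin d → ℝ) × S) => if z.1 ∈ paramSpace I then
      (t j)⁻¹ • (Real.log (q (z.1 + t j • Pi.single k 1, z.2)) - Real.log (q z)) else 0)
    (fun j => ?_) (tendsto_pi_nhds.2 fun z => ?_)
  · refine Measurable.ite hs ?_ measurable_const
    have hz : Measurable fun z : (Fin d → ℝ) × S =>
        (z.1 + t j • (Pi.single k 1 : Fin d → ℝ), z.2) := by fun_prop
    exact ((hq.comp hz).log.sub hq.log).const_mul _
  · by_cases hz : z.1 ∈ paramSpace I
    · simp only [hz, if_true]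
      have h : HasDerivAt (fun t : ℝ => Real.log (p (z.1 + t • Pi.single k 1) z.2))
        (score p z.2 z.1 k) 0 := hp.hasLineDerivAt_log hz z.2 k
      have h2 := h.tendsto_slope_zero.comp ht0
      refine h2.congr' ?_
      filter_upwards [((tendsto_line z.1 (Pi.single k 1)).comp
        (ht0.mono_right nhdsWithin_le_nhds)).eventually (hΘ.mem_nhds hz)] with j hj
      have hj' : z.1 + t j • Pi.single k 1 ∈ paramSpace I := hj
      simp [hqp _ hj', ← hqp _ hz z.2]
    · simp only [hz, if_false]
      exact tendsto_const_nhds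

theorem IsRegularModel.measurable_score (hp : IsRegularModel I p ν) {θ : Fin d → ℝ}
    (hθ : θ ∈ paramSpace I) (k : Fin d) : Measurable fun x => score p x θ k := by
  classical
  have h := (hp.measurable_ite_score k).comp (measurable_prodMk_left (x := θ))
  simpa [Function.comp_def, hθ] using h

/-- The score has mean zero. -/
theorem IsRegularModel.integral_score (hp : IsRegularModel I p ν) {θ : Fin d → ℝ}
    (hθ : θ ∈ paramSpace I) (k : Fin d) :
    ∫ x, score p x θ k ∂(modelLaw p ν θ) = 0 := by
  have hΘ := hp.isOpen_paramSpace
  obtain ⟨U, hU, g, hgi, hg⟩ := hp.dominated θ (subset_closure hθ)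
  set v : Fin d → ℝ := Pi.single k 1 with hv
  have hs : (fun t : ℝ => θ + t • v) ⁻¹' (U ∩ paramSpace I) ∈ 𝓝 (0 : ℝ) :=
    tendsto_line θ v (inter_mem hU (hΘ.mem_nhds hθ))
  have h1 := (hasDerivAt_integral_of_dominated_loc_of_deriv_le (μ := ν) (x₀ := (0 : ℝ))
    (F := fun t x => p (θ + t • v) x) (bound := g)
    (F' := fun t x => lineDeriv ℝ (fun ϑ => p ϑ x) (θ + t • v) v) hs ?_ ?_ ?_ ?_ hgi ?_).2
  -- The total mass is constantly 1 near `θ`, so its derivative, which is the integral of `p` times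
  -- the score, vanishes.
  · have h2 : HasDerivAt (fun t : ℝ => ∫ x, p (θ + t • v) x ∂ν) 0 0 := by
      refine (hasDerivAt_const (0 : ℝ) (1 : ℝ)).congr_of_eventuallyEq ?_
      filter_upwards [hs] with t ht
      exact hp.integral_eq_one ht.2
    have h3 := h1.unique h2
    rw [modelLaw, integral_withDensity_eq_integral_toReal_smul
      (hp.measurable θ hθ).ennreal_ofReal (Eventually.of_forall fun x => ENNReal.ofReal_lt_top),
      ← h3]
    refine integral_congr_ae (Eventually.of_forall fun x => ?_)
    simp only [zero_smul, add_zero]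
    rw [hp.lineDeriv_eq hθ, ENNReal.toReal_ofReal (hp.pos θ hθ x).le, smul_eq_mul]
  · filter_upwards [hs] with t ht
    exact (hp.measurable _ ht.2).aestronglyMeasurable
  · simpa using hp.integrable hθ
  · have : (fun x => lineDeriv ℝ (fun ϑ => p ϑ x) (θ + (0 : ℝ) • v) v)
        = fun x => p θ x * score p x θ k := by
      funext x
      simp only [zero_smul, add_zero]
      exact hp.lineDeriv_eq hθ x k
    simp only [this]
    exact ((hp.measurable θ hθ).mul (hp.measurable_score hθ k)).aestronglyMeasurable
  · exact Eventually.of_forall fun x t ht => hg _ ht x k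
  · exact Eventually.of_forall fun x t ht => hasDerivAt_line_of_hasLineDerivAt
      (hp.hasLineDerivAt ht.2 x k).lineDifferentiableAt.hasLineDerivAt

end Model

/-! ### Conditional sampling and convergence of martingale series -/

section Abstract

variable {Ω E S : Type*} {mΩ : MeasurableSpace Ω} [MeasurableSpace E] [MeasurableSpace S]
  {μ : Measure Ω} [IsProbabilityMeasure μ]

/-- If, given `m`, the variable `Y` has law `κ T` with `T` measurable with respect to `m`, then on
every event of `m` the joint law of `T` and `Y` is the composition of the law of `T` with `κ`. -/
theorem map_prodMk_restrict_eq_compProd {Ω : Type*} {m mΩ : MeasurableSpace Ω}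
    {μ : Measure Ω} [IsProbabilityMeasure μ] (hm : m ≤ mΩ) {T : Ω → E}
    (hT : Measurable[m] T) {Y : Ω → S} (hY : Measurable Y) {κ : Kernel E S} [IsMarkovKernel κ]
    (h : ∀ B, MeasurableSet B → μ[(Y ⁻¹' B).indicator (fun _ => (1 : ℝ)) | m]
      =ᵐ[μ] fun ω => (κ (T ω)).real B) {A : Set Ω} (hA : MeasurableSet[m] A) :
    (μ.restrict A).map (fun ω => (T ω, Y ω)) = ((μ.restrict A).map T) ⊗ₘ κ := by
  have hT' : Measurable T := hT.mono hm le_rfl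
  refine Measure.ext_prod fun {s t} hs ht => ?_
  have hsA : MeasurableSet[m] (T ⁻¹' s ∩ A) := (hT hs).inter hA
  rw [Measure.map_apply (hT'.prodMk hY) (hs.prod ht), Measure.compProd_apply_prod hs ht,
    setLIntegral_map hs (κ.measurable_coe ht) hT', Measure.restrict_restrict (hT' hs)]
  have h1 : ∫ ω in T ⁻¹' s ∩ A, (κ (T ω)).real t ∂μ
      = ∫ ω in T ⁻¹' s ∩ A, (Y ⁻¹' t).indicator (fun _ => (1 : ℝ)) ω ∂μ := by
    rw [← setIntegral_condExp hm ((integrable_const (1 : ℝ)).indicator (hY ht)) hsA]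
    exact integral_congr_ae (ae_restrict_of_ae (h t ht).symm)
  rw [integral_indicator (hY ht), Measure.restrict_restrict (hY ht)] at h1
  simp only [integral_const, smul_eq_mul, mul_one] at h1
  have h2 : ∫⁻ ω in T ⁻¹' s ∩ A, κ (T ω) t ∂μ
      = ENNReal.ofReal (∫ ω in T ⁻¹' s ∩ A, (κ (T ω)).real t ∂μ) := by
    simp only [Measure.real]
    rw [integral_toReal, ENNReal.ofReal_toReal]
    · refine ((lintegral_mono (g := fun _ => 1) fun ω => prob_le_one).trans_lt ?_).ne
      simp
    · exact ((κ.measurable_coe ht).comp hT').aemeasurable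
    · exact Eventually.of_forall fun ω => measure_lt_top _ _
  rw [h2, h1]
  simp only [Measure.real, Measure.restrict_apply .univ, Set.univ_inter]
  rw [ENNReal.ofReal_toReal (measure_ne_top _ _), Measure.restrict_apply
    ((hT'.prodMk hY) (hs.prod ht))]
  congr 1
  ext ω
  simp only [Set.mem_inter_iff, Set.mem_preimage, Set.mem_prod]
  tauto

theorem integral_mul_indicator_eq {Ω : Type*} {m mΩ : MeasurableSpace Ω}
    {μ : Measure Ω} [IsProbabilityMeasure μ] (hm : m ≤ mΩ) {V f : Ω → ℝ}
    (hV : StronglyMeasurable[m] V) (hb : ∀ ω, |V ω| ≤ 1) {B : Set Ω} (hB : MeasurableSet B)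
    (h : μ[B.indicator (fun _ => (1 : ℝ)) | m] =ᵐ[μ] f) :
    ∫ ω, V ω * B.indicator (fun _ => (1 : ℝ)) ω ∂μ = ∫ ω, V ω * f ω ∂μ := by
  have hi : Integrable (B.indicator (fun _ => (1 : ℝ))) μ :=
    (integrable_const (1 : ℝ)).indicator hB
  rw [← integral_condExp hm]
  refine integral_congr_ae ?_
  filter_upwards [condExp_stronglyMeasurable_mul_of_bound hm hV hi 1
    (Eventually.of_forall hb), h] with ω h1 h2
  exact h1.trans (by simp [h2])

/-- Almost sure convergence of a series of martingale differences with summable variances. -/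
theorem ae_exists_tendsto_sum_range {𝒢 : Filtration ℕ mΩ} {D : ℕ → Ω → ℝ}
    (hD : ∀ j, StronglyMeasurable[𝒢 (j + 1)] (D j)) (hL : ∀ j, MemLp (D j) 2 μ)
    (h0 : ∀ j, μ[D j | 𝒢 j] =ᵐ[μ] 0) {c : ℕ → ℝ} (hc : Summable c)
    (hDc : ∀ j, ∫ ω, D j ω ^ 2 ∂μ ≤ c j) :
    ∀ᵐ ω ∂μ, ∃ l, Tendsto (fun N => ∑ i ∈ Finset.range N, D i ω) atTop (𝓝 l) := by
  set M : ℕ → Ω → ℝ := fun N ω => ∑ i ∈ Finset.range N, D i ω with hMdef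
  have hM2 : ∀ N, MemLp (M N) 2 μ := fun N => memLp_finsetSum _ fun i _ => hL i
  have hMm : StronglyAdapted 𝒢 M := fun N =>
    Finset.stronglyMeasurable_fun_sum _ fun i hi =>
      (hD i).mono (𝒢.mono (Finset.mem_range.1 hi))
  have hMi : ∀ N, Integrable (M N) μ := fun N => (hM2 N).integrable (by norm_num)
  have hDi : ∀ N, Integrable (D N) μ := fun N => (hL N).integrable (by norm_num)
  have hsucc : ∀ N, M (N + 1) = M N + D N := fun N => by
    funext ω
    simp [hMdef, Finset.sum_range_succ]
  have hmart : Martingale M 𝒢 μ := by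
    refine martingale_nat hMm hMi fun N => ?_
    rw [hsucc]
    filter_upwards [condExp_add (hMi N) (hDi N) (𝒢 N), h0 N] with ω h1 h2
    rw [h1, Pi.add_apply, h2, condExp_of_stronglyMeasurable (𝒢.le N) (hMm N) (hMi N)]
    simp
  -- Orthogonality of increments: `M N` is known at time `N`, where `D N` has conditional mean zero.
  -- Second moments of the partial sums thus add up.
  have hcross : ∀ N, ∫ ω, M N ω * D N ω ∂μ = 0 := by
    intro N
    have hMD : Integrable (M N * D N) μ := (hM2 N).integrable_mul (hL N)
    have h1 : ∫ ω, (M N * D N) ω ∂μ = 0 := by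
      rw [← integral_condExp (𝒢.le N)]
      refine integral_eq_zero_of_ae ?_
      filter_upwards [condExp_mul_of_stronglyMeasurable_left (hMm N) hMD (hDi N), h0 N]
        with ω h1 h2
      simp [h1, h2]
    exact h1
  have hsq : ∀ N, ∫ ω, M N ω ^ 2 ∂μ ≤ ∑ i ∈ Finset.range N, c i := by
    intro N
    induction N with
    | zero => simp [hMdef]
    | succ N ih =>
      have hMD : Integrable (fun ω => M N ω * D N ω) μ := (hM2 N).integrable_mul (hL N)
      have hI : Integrable (fun ω => M N ω ^ 2 + 2 * (M N ω * D N ω)) μ :=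
        (hM2 N).integrable_sq.add (hMD.const_mul 2)
      have h1 : ∫ ω, M (N + 1) ω ^ 2 ∂μ
          = ∫ ω, M N ω ^ 2 ∂μ + 2 * ∫ ω, M N ω * D N ω ∂μ + ∫ ω, D N ω ^ 2 ∂μ := by
        rw [← integral_const_mul, ← integral_add (hM2 N).integrable_sq (hMD.const_mul 2),
          ← integral_add hI (hL N).integrable_sq]
        refine integral_congr_ae (Eventually.of_forall fun ω => ?_)
        simp only [hsucc, Pi.add_apply]
        ring
      rw [h1, hcross, Finset.sum_range_succ]
      linarith [hDc N]
  have hc0 : ∀ j, 0 ≤ c j := fun j => (integral_nonneg fun ω => sq_nonneg _).trans (hDc j)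
  -- The inequality `|x| ≤ 1 + x ^ 2` turns the L² bound into the L¹ bound that Doob's convergence
  -- theorem needs.
  have hbdd : ∀ N, eLpNorm (M N) 1 μ ≤ ((1 + ∑' i, c i).toNNReal : ENNReal) := by
    intro N
    rw [eLpNorm_one_eq_lintegral_enorm, ← ofReal_integral_norm_eq_lintegral_enorm (hMi N)]
    refine ENNReal.ofReal_le_ofReal ?_
    calc ∫ ω, ‖M N ω‖ ∂μ ≤ ∫ ω, (1 + M N ω ^ 2) ∂μ := by
          refine integral_mono (hMi N).norm ((integrable_const _).add (hM2 N).integrable_sq)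
            fun ω => ?_
          simp only [Real.norm_eq_abs]
          nlinarith [sq_nonneg (|M N ω| - 1), sq_abs (M N ω), abs_nonneg (M N ω)]
      _ = 1 + ∫ ω, M N ω ^ 2 ∂μ := by
          rw [integral_add (integrable_const _) (hM2 N).integrable_sq]
          simp
      _ ≤ 1 + ∑' i, c i := by
          have := hc.sum_le_tsum (Finset.range N) fun i _ => hc0 i
          linarith [hsq N]
  filter_upwards [hmart.submartingale.ae_tendsto_limitProcess hbdd] with ω h
  exact ⟨_, h⟩

/-! ### Asymptotic factorisation when the sampling laws converge setwise -/

section Asymptotics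

variable {𝒢 : Filtration ℕ mΩ} {κ : Kernel E S} [IsMarkovKernel κ] {T : ℕ → Ω → E}
  {Tlim : Ω → E} {Y : ℕ → Ω → S}

theorem measurable_kernel_real (κ : Kernel E S) {B : Set S} (hB : MeasurableSet B) :
    Measurable fun θ => (κ θ).real B :=
  (κ.measurable_coe hB).ennreal_toReal

/-- Induction on the number of observations, peeling off the last. Conditioning on `𝒢 (j + k)`
replaces its indicator by `κ (T (j + k))`. Replacing that by `κ (T j)` costs little, since both
converge to the same limit. The resulting factor is known at time `j` and joins the weight; this is
why the statement carries an arbitrary bounded adapted `W`. -/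
theorem tendsto_integral_mul_prod_indicator_sub (hT : ∀ j, Measurable[𝒢 j] (T j))
    (hY : ∀ j, Measurable[𝒢 (j + 1)] (Y j))
    (hs : ∀ j, ∀ B, MeasurableSet B → μ[(Y j ⁻¹' B).indicator (fun _ => (1 : ℝ)) | 𝒢 j]
      =ᵐ[μ] fun ω => (κ (T j ω)).real B)
    (hlim : ∀ B, MeasurableSet B → ∀ᵐ ω ∂μ, Tendsto (fun j => (κ (T j ω)).real B) atTop
      (𝓝 ((κ (Tlim ω)).real B)))
    {A : ℕ → Set S} (hA : ∀ i, MeasurableSet (A i)) (k : ℕ) {W : ℕ → Ω → ℝ}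
    (hW : ∀ j, StronglyMeasurable[𝒢 j] (W j)) (hWb : ∀ j ω, |W j ω| ≤ 1) :
    Tendsto (fun j =>
      ∫ ω, W j ω * ∏ i ∈ Finset.range k, (Y (j + i) ⁻¹' A i).indicator (fun _ => (1 : ℝ)) ω ∂μ
        - ∫ ω, W j ω * ∏ i ∈ Finset.range k, (κ (T j ω)).real (A i) ∂μ) atTop (𝓝 0) := by
  induction k generalizing W with
  | zero => simp
  | succ k ih =>
    set F : ℕ → Ω → ℝ := fun j ω => (κ (T j ω)).real (A k) with hF
    have hF0 : ∀ j ω, 0 ≤ F j ω := fun j ω => measureReal_nonneg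
    have hF1 : ∀ j ω, F j ω ≤ 1 := fun j ω => measureReal_le_one
    have hFm : ∀ j, StronglyMeasurable[𝒢 j] (F j) := fun j =>
      ((measurable_kernel_real κ (hA k)).comp (hT j)).stronglyMeasurable
    have hFm' : ∀ j, StronglyMeasurable (F j) := fun j => (hFm j).mono (𝒢.le j)
    set V : ℕ → Ω → ℝ := fun j ω => W j ω *
      ∏ i ∈ Finset.range k, (Y (j + i) ⁻¹' A i).indicator (fun _ => (1 : ℝ)) ω with hV
    have hVm : ∀ j, StronglyMeasurable[𝒢 (j + k)] (V j) := fun j => by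
      refine ((hW j).mono (𝒢.mono (Nat.le_add_right j k))).mul
        (Finset.stronglyMeasurable_fun_prod _ fun i hi => ?_)
      have hle : j + i + 1 ≤ j + k := by
        have := Finset.mem_range.1 hi
        omega
      exact stronglyMeasurable_const.indicator (𝒢.mono hle _ (hY (j + i) (hA i)))
    have hVm' : ∀ j, StronglyMeasurable (V j) := fun j => (hVm j).mono (𝒢.le _)
    have hVb : ∀ j ω, |V j ω| ≤ 1 := fun j ω => by
      simp only [hV, abs_mul, Finset.abs_prod]
      refine mul_le_one₀ (hWb j ω) (Finset.prod_nonneg fun _ _ => abs_nonneg _)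
        (Finset.prod_le_one (fun _ _ => abs_nonneg _) fun i _ => ?_)
      by_cases h : ω ∈ Y (j + i) ⁻¹' A i <;> simp [h]
    have hint : ∀ j l, Integrable (fun ω => V j ω * F l ω) μ := fun j l =>
      Integrable.of_bound ((hVm' j).mul (hFm' l)).aestronglyMeasurable 1
        (Eventually.of_forall fun ω => by
          rw [Real.norm_eq_abs, abs_mul, abs_of_nonneg (hF0 l ω)]
          exact mul_le_one₀ (hVb j ω) (hF0 l ω) (hF1 l ω))
    have h1 : ∀ j, ∫ ω, W j ω * ∏ i ∈ Finset.range (k + 1),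
        (Y (j + i) ⁻¹' A i).indicator (fun _ => (1 : ℝ)) ω ∂μ
        = ∫ ω, V j ω * F (j + k) ω ∂μ := fun j => by
      rw [← integral_mul_indicator_eq (𝒢.le (j + k)) (hVm j) (hVb j)
        ((hY (j + k)).mono (𝒢.le _) le_rfl (hA k)) (hs (j + k) (A k) (hA k))]
      simp only [hV, Finset.prod_range_succ, mul_assoc]
    have h2 := ih (W := fun j ω => W j ω * F j ω) (fun j => (hW j).mul (hFm j))
      (fun j ω => by
        rw [abs_mul, abs_of_nonneg (hF0 j ω)]
        exact mul_le_one₀ (hWb j ω) (hF0 j ω) (hF1 j ω))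
    -- The cost of freezing the parameter at time `j` instead of `j + k`, by dominated convergence.
    have h3 : Tendsto (fun j => ∫ ω, V j ω * (F (j + k) ω - F j ω) ∂μ) atTop (𝓝 0) := by
      have h4 := tendsto_integral_of_dominated_convergence (μ := μ)
        (F := fun j ω => V j ω * (F (j + k) ω - F j ω)) (f := fun _ => 0) (fun _ => 1)
        (fun j => ((hVm' j).mul ((hFm' _).sub (hFm' _))).aestronglyMeasurable)
        (integrable_const _)
        (fun j => Eventually.of_forall fun ω => ?_) ?_
      · simpa using h4
      · rw [Real.norm_eq_abs, abs_mul]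
        refine mul_le_one₀ (hVb j ω) (abs_nonneg _) (abs_le.2 ⟨?_, ?_⟩)
        · linarith [hF0 (j + k) ω, hF1 j ω]
        · linarith [hF1 (j + k) ω, hF0 j ω]
      · filter_upwards [hlim (A k) (hA k)] with ω hω
        have h5 : Tendsto (fun j => F (j + k) ω - F j ω) atTop (𝓝 0) := by
          have := ((tendsto_add_atTop_iff_nat k).2 hω).sub hω
          simpa using this
        refine squeeze_zero_norm (fun j => ?_) (tendsto_norm_zero.comp h5)
        rw [norm_mul]
        exact mul_le_of_le_one_left (norm_nonneg _) (hVb j ω)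
    refine (h3.add h2).congr' (Eventually.of_forall fun j => ?_) |>.trans (by simp)
    have e1 : ∫ ω, V j ω * (F (j + k) ω - F j ω) ∂μ
        = ∫ ω, V j ω * F (j + k) ω ∂μ - ∫ ω, V j ω * F j ω ∂μ := by
      rw [← integral_sub (hint _ _) (hint _ _)]
      simp only [mul_sub]
    have e2 : ∫ ω, V j ω * F j ω ∂μ = ∫ ω, W j ω * F j ω *
        ∏ i ∈ Finset.range k, (Y (j + i) ⁻¹' A i).indicator (fun _ => (1 : ℝ)) ω ∂μ := by
      refine integral_congr_ae (Eventually.of_forall fun ω => ?_)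
      simp only [hV]
      ring
    have e3 : ∫ ω, W j ω * F j ω * ∏ i ∈ Finset.range k, (κ (T j ω)).real (A i) ∂μ
        = ∫ ω, W j ω * ∏ i ∈ Finset.range (k + 1), (κ (T j ω)).real (A i) ∂μ := by
      refine integral_congr_ae (Eventually.of_forall fun ω => ?_)
      simp only [Finset.prod_range_succ, hF]
      ring
    rw [h1, e1, e2, e3]
    ring

/-- Asymptotically the observations are distributed on rectangles as a mixture of product laws. -/
theorem tendsto_measureReal_iInter (hT : ∀ j, Measurable[𝒢 j] (T j))
    (hY : ∀ j, Measurable[𝒢 (j + 1)] (Y j))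
    (hs : ∀ j, ∀ B, MeasurableSet B → μ[(Y j ⁻¹' B).indicator (fun _ => (1 : ℝ)) | 𝒢 j]
      =ᵐ[μ] fun ω => (κ (T j ω)).real B)
    (hlim : ∀ B, MeasurableSet B → ∀ᵐ ω ∂μ, Tendsto (fun j => (κ (T j ω)).real B) atTop
      (𝓝 ((κ (Tlim ω)).real B)))
    {A : ℕ → Set S} (hA : ∀ i, MeasurableSet (A i)) (k : ℕ) :
    Tendsto (fun j => μ.real (⋂ i ∈ Finset.range k, Y (j + i) ⁻¹' A i)) atTop
      (𝓝 (∫ ω, ∏ i ∈ Finset.range k, (κ (Tlim ω)).real (A i) ∂μ)) := by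
  have h1 := tendsto_integral_mul_prod_indicator_sub hT hY hs hlim hA k (W := fun _ _ => 1)
    (fun _ => stronglyMeasurable_const) (fun _ _ => by simp)
  have h2 : Tendsto (fun j => ∫ ω, ∏ i ∈ Finset.range k, (κ (T j ω)).real (A i) ∂μ) atTop
      (𝓝 (∫ ω, ∏ i ∈ Finset.range k, (κ (Tlim ω)).real (A i) ∂μ)) := by
    refine tendsto_integral_of_dominated_convergence (fun _ => 1) (fun j => ?_)
      (integrable_const _) (fun j => Eventually.of_forall fun ω => ?_) ?_
    · refine (Finset.measurable_fun_prod _ fun i _ => ?_).aestronglyMeasurable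
      exact (measurable_kernel_real κ (hA i)).comp ((hT j).mono (𝒢.le j) le_rfl)
    · rw [Real.norm_eq_abs, Finset.abs_prod]
      refine Finset.prod_le_one (fun _ _ => abs_nonneg _) fun i _ => ?_
      rw [abs_of_nonneg measureReal_nonneg]
      exact measureReal_le_one
    · have := ae_all_iff.2 fun i => hlim (A i) (hA i)
      filter_upwards [this] with ω hω
      exact tendsto_finsetProd _ fun i _ => hω i
  have h3 := h1.add h2
  simp only [one_mul, sub_add_cancel, zero_add] at h3
  refine h3.congr fun j => ?_
  have hm : MeasurableSet (⋂ i ∈ Finset.range k, Y (j + i) ⁻¹' A i) :=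
    Finset.measurableSet_biInter _ fun i _ => (hY (j + i)).mono (𝒢.le _) le_rfl (hA i)
  rw [← integral_indicator_one hm]
  refine integral_congr_ae (Eventually.of_forall fun ω => ?_)
  dsimp only
  by_cases h : ω ∈ ⋂ i ∈ Finset.range k, Y (j + i) ⁻¹' A i
  · rw [Set.indicator_of_mem h]
    refine Finset.prod_eq_one fun i hi => ?_
    exact Set.indicator_of_mem (Set.mem_iInter₂.1 h i hi) _
  · rw [Set.indicator_of_notMem h]
    simp only [Set.mem_iInter, not_forall] at h
    obtain ⟨i, hi, h⟩ := h
    exact Finset.prod_eq_zero hi (Set.indicator_of_notMem h _)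

end Asymptotics

end Abstract

/-! ### Mixtures of i.i.d. sequences, and weak convergence from rectangles -/

section Mixture

variable {E S : Type*} [MeasurableSpace E] [MeasurableSpace S]

/-- The kernel sending a parameter to the law of an i.i.d. sequence drawn from `κ`. -/
noncomputable def iidKernel (κ : Kernel E S) [IsMarkovKernel κ] : Kernel E (ℕ → S) where
  toFun θ := Measure.infinitePi fun _ => κ θ
  measurable' := by
    refine Measurable.measure_of_isPiSystem_of_isProbabilityMeasure
      (generateFrom_squareCylinders (α := fun _ : ℕ => S)).symm
      (isPiSystem_squareCylinders (fun _ => MeasurableSpace.isPiSystem_measurableSet)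
        (fun _ => MeasurableSet.univ)) ?_
    rintro _ ⟨s, t, ht, rfl⟩
    have ht' : ∀ i, MeasurableSet (t i) := fun i => ht i (Set.mem_univ i)
    simp only [Measure.infinitePi_pi _ fun i _ => ht' i]
    exact Finset.measurable_fun_prod _ fun i _ => κ.measurable_coe (ht' i)

variable (κ : Kernel E S) [IsMarkovKernel κ] (π : Measure E) [IsProbabilityMeasure π]

instance : IsMarkovKernel (iidKernel κ) :=
  ⟨fun θ => inferInstanceAs (IsProbabilityMeasure (Measure.infinitePi fun _ => κ θ))⟩

theorem iidKernel_pi (θ : E) {s : Finset ℕ} {A : ℕ → Set S} (hA : ∀ i, MeasurableSet (A i)) :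
    iidKernel κ θ (Set.pi s A) = ∏ i ∈ s, κ θ (A i) :=
  Measure.infinitePi_pi _ fun i _ => hA i

theorem compProd_iidKernel_prod_pi {B : Set E} (hB : MeasurableSet B) {s : Finset ℕ}
    {A : ℕ → Set S} (hA : ∀ i, MeasurableSet (A i)) :
    (π ⊗ₘ iidKernel κ) (B ×ˢ Set.pi s A) = ∫⁻ θ in B, ∏ i ∈ s, κ θ (A i) ∂π := by
  rw [Measure.compProd_apply_prod hB (MeasurableSet.pi s.countable_toSet fun i _ => hA i)]
  simp only [iidKernel_pi κ _ hA]

theorem compProd_iidKernel_preimage_pi {s : Finset ℕ}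
    {A : ℕ → Set S} (hA : ∀ i, MeasurableSet (A i)) :
    (π ⊗ₘ iidKernel κ) (Prod.snd ⁻¹' Set.pi s A) = ∫⁻ θ, ∏ i ∈ s, κ θ (A i) ∂π := by
  rw [← Set.univ_prod, compProd_iidKernel_prod_pi κ π .univ hA, Measure.restrict_univ]

theorem setIntegral_prod_measureReal (κ : Kernel E S) [IsMarkovKernel κ]
    (π : Measure E) (B : Set E) {s : Finset ℕ} {A : ℕ → Set S}
    (hA : ∀ i, MeasurableSet (A i)) :
    ∫ θ in B, ∏ i ∈ s, (κ θ).real (A i) ∂π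
      = (∫⁻ θ in B, ∏ i ∈ s, κ θ (A i) ∂π).toReal := by
  rw [← integral_toReal]
  · simp only [Measure.real, ENNReal.toReal_prod]
  · exact (Finset.measurable_fun_prod _ fun i _ => κ.measurable_coe (hA i)).aemeasurable
  · exact Eventually.of_forall fun θ => ENNReal.prod_lt_top fun i _ => measure_lt_top _ _

theorem integrable_prod_measureReal {Ω : Type*} {mΩ : MeasurableSpace Ω} (μ : Measure Ω)
    [IsFiniteMeasure μ] {T : Ω → E} (hT : Measurable T) {s : Finset ℕ} {A : ℕ → Set S}
    (hA : ∀ i, MeasurableSet (A i)) :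
    Integrable (fun ω => ∏ i ∈ s, (κ (T ω)).real (A i)) μ := by
  refine Integrable.of_bound (Finset.measurable_fun_prod _ fun i _ =>
    (measurable_kernel_real κ (hA i)).comp hT).aestronglyMeasurable 1
    (Eventually.of_forall fun ω => ?_)
  rw [Real.norm_eq_abs, abs_of_nonneg (Finset.prod_nonneg fun _ _ => measureReal_nonneg)]
  exact Finset.prod_le_one (fun _ _ => measureReal_nonneg) fun _ _ => measureReal_le_one

/-- Events of the first coordinate are cylinders over sets `B` of parameters, and over each of them
both sides integrate to the integral over `B` of the product of the `κ θ (A i)`. -/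
theorem condIID_compProd_iidKernel {d : ℕ} {S : Type*} [MeasurableSpace S]
    (κ : Kernel (Fin d → ℝ) S) [IsMarkovKernel κ] (π : Measure (Fin d → ℝ))
    [IsProbabilityMeasure π] :
    CondIID (π ⊗ₘ iidKernel κ) (fun θ => κ θ) Prod.fst (fun i ω => ω.2 i) := by
  intro s A hA
  have hset : (⋂ i ∈ s, (fun ω : (Fin d → ℝ) × (ℕ → S) => ω.2 i) ⁻¹' A i)
      = Prod.snd ⁻¹' Set.pi s A := by
    ext ω
    simp [Set.mem_pi]
  have hm : MeasurableSet (Prod.snd ⁻¹' Set.pi s A : Set ((Fin d → ℝ) × (ℕ → S))) :=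
    measurable_snd (MeasurableSet.pi s.countable_toSet fun i _ => hA i)
  have hle : MeasurableSpace.comap (Prod.fst : (Fin d → ℝ) × (ℕ → S) → Fin d → ℝ) inferInstance
      ≤ (inferInstance : MeasurableSpace ((Fin d → ℝ) × (ℕ → S))) := measurable_fst.comap_le
  rw [hset]
  symm
  refine ae_eq_condExp_of_forall_setIntegral_eq hle ((integrable_const (1 : ℝ)).indicator hm)
    (fun _ _ _ => (integrable_prod_measureReal κ _ measurable_fst hA).integrableOn) ?_ ?_
  · rintro _ ⟨B, hB, rfl⟩ -
    rw [integral_indicator hm, Measure.restrict_restrict hm]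
    simp only [integral_const, smul_eq_mul, mul_one]
    rw [← setIntegral_map hB (f := fun θ => ∏ i ∈ s, (κ θ).real (A i))
      (integrable_prod_measureReal κ (Measure.map Prod.fst (π ⊗ₘ iidKernel κ))
        measurable_id hA).aestronglyMeasurable measurable_fst.aemeasurable]
    have hfst : Measure.map Prod.fst (π ⊗ₘ iidKernel κ) = π := Measure.fst_compProd _ _
    rw [hfst, setIntegral_prod_measureReal κ π B hA,
      ← compProd_iidKernel_prod_pi κ π hB hA, Measure.real, Measure.restrict_apply .univ,
      Set.univ_inter, Set.prod_eq, Set.inter_comm]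
  · have h1 : Measurable fun θ : Fin d → ℝ => ∏ i ∈ s, (κ θ).real (A i) :=
      Finset.measurable_fun_prod _ fun i _ => measurable_kernel_real κ (hA i)
    exact (h1.comp (comap_measurable _)).stronglyMeasurable.aestronglyMeasurable

/-- For any `k` distinct indices a rectangle has the same mixed product as its probability, so
permuting the indices changes nothing; rectangles generate the product σ-algebra. -/
theorem exchangeable_compProd_iidKernel :
    Exchangeable (π ⊗ₘ iidKernel κ) (fun i ω => ω.2 i) := by
  intro k σ
  have hmeas : ∀ e : Fin k → ℕ, Measurable fun (ω : E × (ℕ → S)) i => ω.2 (e i) := fun e => by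
    fun_prop
  have key : ∀ e : Fin k ↪ ℕ, ∀ A : Fin k → Set S, (∀ i, MeasurableSet (A i)) →
      (π ⊗ₘ iidKernel κ).map (fun ω i => ω.2 (e i)) (Set.pi Set.univ A)
        = ∫⁻ θ, ∏ i, κ θ (A i) ∂π := by
    intro e A hA
    rw [Measure.map_apply (hmeas e) (MeasurableSet.univ_pi hA)]
    -- Coordinates outside the range of `e` are left unconstrained.
    have hA' : ∀ j, MeasurableSet (Function.extend e A (fun _ => Set.univ) j) := by
      intro j
      by_cases hj : ∃ i, e i = j
      · obtain ⟨i, rfl⟩ := hj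
        rw [e.injective.extend_apply]
        exact hA i
      · rw [Function.extend_apply' _ _ _ hj]
        exact .univ
    have hset : (fun (ω : E × (ℕ → S)) i => ω.2 (e i)) ⁻¹' Set.pi Set.univ A
        = Prod.snd ⁻¹' Set.pi (Finset.univ.map e) (Function.extend e A fun _ => Set.univ) := by
      ext ω
      simp [Set.mem_pi, e.injective.extend_apply]
    rw [hset, compProd_iidKernel_preimage_pi κ π hA']
    simp only [Finset.prod_map, e.injective.extend_apply]
  have : IsProbabilityMeasure ((π ⊗ₘ iidKernel κ).map fun ω (i : Fin k) => ω.2 (σ i)) :=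
    Measure.isProbabilityMeasure_map (hmeas fun i => σ i).aemeasurable
  refine ext_of_generate_finite _ generateFrom_pi.symm isPiSystem_pi ?_ ?_
  · rintro _ ⟨A, hA, rfl⟩
    have hA' : ∀ i, MeasurableSet (A i) := fun i => hA i (Set.mem_univ i)
    have h1 := key (σ.toEmbedding.trans Fin.valEmbedding) A hA'
    have h2 := key Fin.valEmbedding A hA'
    exact h1.trans h2.symm
  · rw [Measure.map_apply (hmeas fun i => σ i) .univ, Measure.map_apply (hmeas fun i => i) .univ]
    rfl

/-- A sequence of processes converges in distribution in the product topology as soon as the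
probabilities of measurable rectangles converge. -/
theorem tendstoInDistribution_of_tendsto_rectangles {Ω Ω' S : Type*} {mΩ : MeasurableSpace Ω}
    {mΩ' : MeasurableSpace Ω'} [TopologicalSpace S] [SecondCountableTopology S]
    [MeasurableSpace S] [OpensMeasurableSpace S]
    {μ : Measure Ω} [IsProbabilityMeasure μ] {P : Measure Ω'} [IsProbabilityMeasure P]
    {X : ℕ → Ω → ℕ → S} {Z : Ω' → ℕ → S} (hX : ∀ j, Measurable (X j)) (hZ : Measurable Z)
    (h : ∀ A : ℕ → Set S, (∀ i, MeasurableSet (A i)) → ∀ k,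
      Tendsto (fun j => μ (X j ⁻¹' Set.pi (Finset.range k) A)) atTop
        (𝓝 (P (Z ⁻¹' Set.pi (Finset.range k) A)))) :
    TendstoInDistribution X atTop Z (fun _ => μ) P where
  forall_aemeasurable j := (hX j).aemeasurable
  aemeasurable_limit := hZ.aemeasurable
  tendsto := by
    have hpi : IsPiSystem (squareCylinders fun _ : ℕ => {s : Set S | MeasurableSet s}) :=
      isPiSystem_squareCylinders (fun _ => MeasurableSpace.isPiSystem_measurableSet)
        (fun _ => MeasurableSet.univ)
    refine hpi.tendsto_probabilityMeasure_of_tendsto_of_mem ?_ ?_ ?_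
    · rintro _ ⟨s, t, ht, rfl⟩
      exact MeasurableSet.pi s.countable_toSet fun i _ => ht i (Set.mem_univ i)
    -- The criterion asks that each point of an open set have a neighbourhood from the π-system
    -- inside that set; basic open sets of the product topology provide it.
    · intro u hu x hx
      obtain ⟨s, t, ht, hsub⟩ := isOpen_pi_iff.1 hu x hx
      classical
      refine ⟨Set.pi s fun i => if i ∈ s then t i else Set.univ,
        ⟨s, _, fun i _ => ?_, rfl⟩, set_pi_mem_nhds s.finite_toSet fun i hi => ?_, ?_⟩
      · by_cases hi : i ∈ s
        · simpa [hi] using (ht i hi).1.measurableSet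
        · simp [hi]
      · have hi' : i ∈ s := hi
        simpa [hi'] using (ht i hi).1.mem_nhds (ht i hi).2
      · intro y hy
        refine hsub fun i hi => ?_
        have hi' : i ∈ s := hi
        simpa [hi'] using hy i hi
    · rintro _ ⟨s, t, ht, rfl⟩
      classical
      obtain ⟨k, hk⟩ : ∃ k, s ⊆ Finset.range k := s.exists_nat_subset_range
      have ht' : ∀ i, MeasurableSet (t i) := fun i => ht i (Set.mem_univ i)
      have hset : Set.pi s t = Set.pi (Finset.range k) fun i => if i ∈ s then t i else Set.univ := by
        ext y
        simp only [Set.mem_pi, Finset.mem_coe]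
        constructor
        · intro hy i _
          by_cases hi : i ∈ s
          · simpa [hi] using hy i hi
          · simp [hi]
        · intro hy i hi
          simpa [hi] using hy i (hk hi)
      have hm : MeasurableSet (Set.pi (s : Set ℕ) t) :=
        MeasurableSet.pi s.countable_toSet fun i _ => ht' i
      have h1 := h (fun i => if i ∈ s then t i else Set.univ)
        (fun i => by by_cases hi : i ∈ s <;> simp [hi, ht' i]) k
      rw [← hset] at h1
      refine (ENNReal.tendsto_toNNReal (measure_ne_top _ _)).comp h1 |>.congr' ?_ |>.trans ?_
      · refine Eventually.of_forall fun j => ?_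
        simp [Measure.map_apply (hX j) hm]
      · simp [Measure.map_apply hZ hm]

end Mixture

/-- A function of a state known at time `m` and of the next observation, with conditional mean
zero and bounded conditional second moments, is a square integrable martingale difference. -/
theorem memLp_and_condExp_eq_zero {Ω E S : Type*} {m mΩ : MeasurableSpace Ω} [MeasurableSpace E]
    [MeasurableSpace S] {μ : Measure Ω} [IsProbabilityMeasure μ] (hm : m ≤ mΩ) {T : Ω → E}
    (hT : Measurable[m] T) {Y : Ω → S} (hY : Measurable Y) {κ : Kernel E S} [IsMarkovKernel κ]
    (h : ∀ B, MeasurableSet B → μ[(Y ⁻¹' B).indicator (fun _ => (1 : ℝ)) | m]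
      =ᵐ[μ] fun ω => (κ (T ω)).real B)
    {f : E × S → ℝ} (hf : Measurable f) {c : ℝ} (hc : 0 ≤ c)
    (hi : ∀ᵐ ω ∂μ, Integrable (fun x => f (T ω, x) ^ 2) (κ (T ω)))
    (hsq : ∀ᵐ ω ∂μ, ∫ x, f (T ω, x) ^ 2 ∂(κ (T ω)) ≤ c)
    (h0 : ∀ᵐ ω ∂μ, ∫ x, f (T ω, x) ∂(κ (T ω)) = 0) :
    MemLp (fun ω => f (T ω, Y ω)) 2 μ ∧ ∫ ω, f (T ω, Y ω) ^ 2 ∂μ ≤ c ∧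
      μ[fun ω => f (T ω, Y ω) | m] =ᵐ[μ] 0 := by
  have hT' : Measurable T := hT.mono hm le_rfl
  have hTY : Measurable fun ω => (T ω, Y ω) := hT'.prodMk hY
  have hD : Measurable fun ω => f (T ω, Y ω) := hf.comp hTY
  -- The joint law on the whole space yields the second moment; its restrictions to events `A` of
  -- `m` identify the conditional expectation.
  have hmap := fun A hA => map_prodMk_restrict_eq_compProd hm hT hY h (A := A) hA
  have hf2 : Measurable fun z => ENNReal.ofReal (f z ^ 2) := (hf.pow_const 2).ennreal_ofReal
  have hlint : ∫⁻ ω, ENNReal.ofReal (f (T ω, Y ω) ^ 2) ∂μ ≤ ENNReal.ofReal c := by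
    have h1 := hmap Set.univ .univ
    rw [Measure.restrict_univ] at h1
    rw [← lintegral_map (f := fun z => ENNReal.ofReal (f z ^ 2)) hf2 hTY, h1,
      Measure.lintegral_compProd hf2, lintegral_map hf2.lintegral_kernel_prod_right' hT']
    calc ∫⁻ ω, ∫⁻ x, ENNReal.ofReal (f (T ω, x) ^ 2) ∂(κ (T ω)) ∂μ
        ≤ ∫⁻ _, ENNReal.ofReal c ∂μ := by
          refine lintegral_mono_ae ?_
          filter_upwards [hi, hsq] with ω h1 h2
          rw [← ofReal_integral_eq_lintegral_ofReal h1
            (Eventually.of_forall fun x => sq_nonneg _)]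
          exact ENNReal.ofReal_le_ofReal h2
      _ = ENNReal.ofReal c := by simp
  have hL : MemLp (fun ω => f (T ω, Y ω)) 2 μ := by
    rw [memLp_two_iff_integrable_sq hD.aestronglyMeasurable]
    refine ⟨(hD.pow_const 2).aestronglyMeasurable, ?_⟩
    rw [hasFiniteIntegral_iff_ofReal (Eventually.of_forall fun ω => sq_nonneg _)]
    exact hlint.trans_lt ENNReal.ofReal_lt_top
  have hDi : Integrable (fun ω => f (T ω, Y ω)) μ := hL.integrable (by norm_num)
  refine ⟨hL, ?_, ?_⟩
  · rw [integral_eq_lintegral_of_nonneg_ae (Eventually.of_forall fun ω => sq_nonneg _)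
      (hD.pow_const 2).aestronglyMeasurable]
    exact ENNReal.toReal_le_of_le_ofReal hc hlint
  · refine (ae_eq_condExp_of_forall_setIntegral_eq hm hDi
      (fun _ _ _ => integrableOn_zero) (fun A hA _ => ?_) aestronglyMeasurable_zero).symm
    have hfm : AEStronglyMeasurable f (Measure.map (fun ω => (T ω, Y ω)) (μ.restrict A)) :=
      hf.aestronglyMeasurable
    have hfi : Integrable f (Measure.map (fun ω => (T ω, Y ω)) (μ.restrict A)) :=
      (integrable_map_measure hfm hTY.aemeasurable).2 hDi.integrableOn
    rw [← integral_map (f := f) hTY.aemeasurable hfm, hmap A hA,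
      Measure.integral_compProd (by rwa [hmap A hA] at hfi), integral_map hT'.aemeasurable
        (hf.stronglyMeasurable.integral_kernel_prod_right').aestronglyMeasurable]
    rw [integral_eq_zero_of_ae (ae_restrict_of_ae h0)]
    simp

/-! ### Almost sure convergence of the score-driven parameters -/

section Scheme

variable {d : ℕ} {S : Type u} [MeasurableSpace S] {I : Fin d → Set ℝ}
  {p : (Fin d → ℝ) → S → ℝ} {ν : Measure S}

theorem fisherInfo_diag_nonneg (θ : Fin d → ℝ) (k : Fin d) : 0 ≤ fisherInfo p ν θ k k := by
  simp only [fisherInfo, Matrix.of_apply]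
  exact integral_nonneg fun x => mul_self_nonneg _

theorem fisherInfo_diag_eq (θ : Fin d → ℝ) (k : Fin d) :
    fisherInfo p ν θ k k = ∫ x, score p x θ k ^ 2 ∂(modelLaw p ν θ) := by
  simp only [fisherInfo, Matrix.of_apply, sq]

/-- In both step-size regimes the steps are measurable functions of the parameter for which the
increments have summable conditional variances. -/
theorem exists_measurable_steps {n : ℕ} {ε : ℕ → (Fin d → ℝ) → Fin d → ℝ}
    (hp : IsRegularModel I p ν) {κ : Kernel (Fin d → ℝ) S} [IsMarkovKernel κ]
    (hκ : ∀ θ ∈ paramSpace I, κ θ = modelLaw p ν θ)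
    (hε : BoundedInfoSteps I p ν n ε ∨ ScaledSteps I p ν n ε) :
    ∃ (a : ℕ → (Fin d → ℝ) → Fin d → ℝ) (c : ℕ → Fin d → ℝ),
      (∀ m k, Measurable fun θ => a m θ k) ∧ (∀ k, Summable fun m => c m k) ∧
      (∀ m k, 0 ≤ c m k) ∧ ∀ m ≥ n, ∀ θ ∈ paramSpace I, ∀ k,
        ε m θ k = a m θ k ∧ a m θ k ^ 2 * fisherInfo p ν θ k k ≤ c m k := by
  classical
  rcases hε with ⟨⟨R, hR, hRb⟩, e, he, hεe⟩ | ⟨τ, hτ, hετ⟩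
  · refine ⟨fun m _ => e m, fun m k => e m k ^ 2 * R, fun m k => measurable_const,
      fun k => (he k).mul_right R, fun m k => by positivity, fun m hm θ hθ k =>
        ⟨hεe m hm θ hθ k, mul_le_mul_of_nonneg_left ?_ (sq_nonneg _)⟩⟩
    refine le_trans ?_ (hRb θ hθ).2
    -- A diagonal entry is at most the trace because all diagonal entries are nonnegative.
    exact Finset.single_le_sum (f := fun k => fisherInfo p ν θ k k)
      (fun i _ => fisherInfo_diag_nonneg θ i) (Finset.mem_univ k)
  -- Integrating the truncated score against the kernel gives a version of the diagonal information
  -- that is measurable on all of `ℝ^d`.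
  · set J : (Fin d → ℝ) → Fin d → ℝ := fun θ k =>
      ∫ x, (if θ ∈ paramSpace I then score p x θ k else 0) ^ 2 ∂(κ θ) with hJ
    have hJm : ∀ k, Measurable fun θ => J θ k := fun k =>
      (((hp.measurable_ite_score k).pow_const 2).stronglyMeasurable
        |>.integral_kernel_prod_right' (κ := κ)).measurable
    have hJe : ∀ θ ∈ paramSpace I, ∀ k, J θ k = fisherInfo p ν θ k k := fun θ hθ k => by
      simp only [hJ, hθ, if_true, hκ θ hθ, fisherInfo_diag_eq]
    refine ⟨fun m θ k => τ m k / √(J θ k), fun m k => τ m k ^ 2,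
      fun m k => measurable_const.div (hJm k).sqrt, hτ, fun m k => sq_nonneg _,
      fun m hm θ hθ k => ⟨by simp only [hετ m hm θ hθ k, hJe θ hθ k], ?_⟩⟩
    have h0 := fisherInfo_diag_nonneg (p := p) (ν := ν) θ k
    simp only [hJe θ hθ k]
    rw [div_pow, Real.sq_sqrt h0]
    -- Where the information vanishes, so does the left side; elsewhere the scaling cancels it and
    -- leaves exactly `τ m k ^ 2`.
    rcases h0.eq_or_lt with h1 | h1
    · simp [← h1, sq_nonneg]
    · rw [div_mul_cancel₀ _ h1.ne']

/-- The parameters of the scheme converge almost surely. -/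
theorem IsScoreScheme.ae_exists_tendsto {n : ℕ} {ε : ℕ → (Fin d → ℝ) → Fin d → ℝ}
    (hp : IsRegularModel I p ν) (hI : HasFisherInfo I p ν)
    {κ : Kernel (Fin d → ℝ) S} [IsMarkovKernel κ]
    (hκ : ∀ θ ∈ paramSpace I, κ θ = modelLaw p ν θ)
    (hε : BoundedInfoSteps I p ν n ε ∨ ScaledSteps I p ν n ε)
    {Ω : Type v} [mΩ : MeasurableSpace Ω] {μ : Measure Ω} [IsProbabilityMeasure μ]
    {ℱ : Filtration ℕ mΩ} {X : ℕ → Ω → S} {θ : ℕ → Ω → Fin d → ℝ}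
    (hX : IsScoreScheme I p ν n ε μ ℱ X θ) {𝒢 : Filtration ℕ mΩ} (h𝒢 : ∀ j, 𝒢 j = ℱ (n + j))
    (hs : ∀ j, ∀ B, MeasurableSet B →
      μ[(X (n + j + 1) ⁻¹' B).indicator (fun _ => (1 : ℝ)) | 𝒢 j]
        =ᵐ[μ] fun ω => (κ (θ (n + j) ω)).real B) :
    ∀ᵐ ω ∂μ, ∃ l, Tendsto (fun j => θ (n + j) ω) atTop (𝓝 l) := by
  classical
  obtain ⟨a, c, ham, hcs, hc0, hac⟩ := exists_measurable_steps hp hκ hε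
  have hTm : ∀ j, Measurable[𝒢 j] (θ (n + j)) := fun j => by
    rw [h𝒢]; exact hX.measurable_param _ (by omega)
  have hYm : ∀ j, Measurable[𝒢 (j + 1)] (X (n + j + 1)) := fun j => by
    rw [h𝒢]; exact hX.measurable_obs (n + j) (by omega)
  have hmem : ∀ j, ∀ᵐ ω ∂μ, θ (n + j) ω ∈ paramSpace I := fun j =>
    hX.mem_paramSpace _ (by omega)
  set f : ℕ → Fin d → (Fin d → ℝ) × S → ℝ := fun j k z =>
    a (n + j) z.1 k * if z.1 ∈ paramSpace I then score p z.2 z.1 k else 0 with hf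
  have hfm : ∀ j k, Measurable (f j k) := fun j k =>
    ((ham (n + j) k).comp measurable_fst).mul (hp.measurable_ite_score k)
  have hinc : ∀ j k, MemLp (fun ω => f j k (θ (n + j) ω, X (n + j + 1) ω)) 2 μ ∧
      ∫ ω, f j k (θ (n + j) ω, X (n + j + 1) ω) ^ 2 ∂μ ≤ c (n + j) k ∧
      μ[fun ω => f j k (θ (n + j) ω, X (n + j + 1) ω) | 𝒢 j] =ᵐ[μ] 0 := by
    intro j k
    refine memLp_and_condExp_eq_zero (𝒢.le j) (hTm j) ((hYm j).mono (𝒢.le _) le_rfl) (hs j)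
      (hfm j k) (hc0 _ _) ?_ ?_ ?_
    · filter_upwards [hmem j] with ω hω
      simp only [hf, hω, if_true, mul_pow, hκ _ hω]
      exact (hI _ hω k).const_mul _
    · filter_upwards [hmem j] with ω hω
      simp only [hf, hω, if_true, mul_pow, hκ _ hω]
      rw [integral_const_mul, ← fisherInfo_diag_eq]
      exact (hac (n + j) (by omega) _ hω k).2
    · filter_upwards [hmem j] with ω hω
      simp only [hf, hω, if_true, hκ _ hω]
      rw [integral_const_mul, hp.integral_score hω, mul_zero]
  have hconv : ∀ k, ∀ᵐ ω ∂μ, ∃ l, Tendsto (fun N => ∑ j ∈ Finset.range N,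
      f j k (θ (n + j) ω, X (n + j + 1) ω)) atTop (𝓝 l) := fun k =>
    ae_exists_tendsto_sum_range (𝒢 := 𝒢)
      (fun j => ((hfm j k).comp (((hTm j).mono (𝒢.mono j.le_succ) le_rfl).prodMk
        (hYm j))).stronglyMeasurable)
      (fun j => (hinc j k).1) (fun j => (hinc j k).2.2)
      ((summable_nat_add_iff n).2 (hcs k)) (fun j => by
        rw [add_comm j n]; exact (hinc j k).2.1)
  have hupd : ∀ j, ∀ᵐ ω ∂μ, ∀ k, θ (n + j + 1) ω k
      = θ (n + j) ω k + ε (n + j) (θ (n + j) ω) k * score p (X (n + j + 1) ω) (θ (n + j) ω) k :=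
    fun j => hX.update (n + j) (by omega)
  filter_upwards [ae_all_iff.2 hconv, ae_all_iff.2 hmem, ae_all_iff.2 hupd] with ω h1 h2 h3
  choose l hl using h1
  -- Telescoping: `θ (n + N)` is `θ n` plus the first `N` increments.
  refine ⟨fun k => θ n ω k + l k, tendsto_pi_nhds.2 fun k => ?_⟩
  refine ((hl k).const_add (θ n ω k)).congr fun N => ?_
  induction N with
  | zero => simp
  | succ N ih =>
    rw [Finset.sum_range_succ, ← add_assoc, ih, ← add_assoc n N 1, h3 N k,
      (hac (n + N) (by omega) _ (h2 N) k).1]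
    simp only [hf, h2 N, if_true]

theorem CondIID.congr {Ω : Type v} [MeasurableSpace Ω] {P : Measure Ω}
    {κ κ' : (Fin d → ℝ) → Measure S} {ϑ : Ω → Fin d → ℝ} {Z : ℕ → Ω → S}
    (h : CondIID P κ ϑ Z) (hκ : ∀ᵐ ω ∂P, κ (ϑ ω) = κ' (ϑ ω)) : CondIID P κ' ϑ Z := by
  intro s A hA
  filter_upwards [h s A hA, hκ] with ω h1 h2
  rw [h1, h2]

end Scheme

end ScoreMartingale

/-! ### The main theorem -/

theorem mainTheorem3
    {d : ℕ} {S : Type u} [TopologicalSpace S] [PolishSpace S] [MeasurableSpace S] [BorelSpace S]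
    (I : Fin d → Set ℝ) (p : (Fin d → ℝ) → S → ℝ) (ν : Measure S) [SigmaFinite ν]
    (hp : ScoreMartingale.IsRegularModel I p ν)
    (hI : ScoreMartingale.HasFisherInfo I p ν)
    (n : ℕ) (ε : ℕ → (Fin d → ℝ) → Fin d → ℝ)
    (hε : ScoreMartingale.BoundedInfoSteps I p ν n ε ∨ ScoreMartingale.ScaledSteps I p ν n ε)
    {Ω : Type v} [mΩ : MeasurableSpace Ω] (μ : Measure Ω) [IsProbabilityMeasure μ]
    (ℱ : Filtration ℕ mΩ) (X : ℕ → Ω → S) (θ : ℕ → Ω → Fin d → ℝ)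
    (hX : ScoreMartingale.IsScoreScheme I p ν n ε μ ℱ X θ) :
    -- the extension of the model to the closure of the parameter space is well defined
    (∀ ϑ ∈ closure (ScoreMartingale.paramSpace I),
      (∀ x, Tendsto (fun ϑ' => p ϑ' x) (𝓝[ScoreMartingale.paramSpace I] ϑ)
        (𝓝 (ScoreMartingale.extendedDensity (ScoreMartingale.paramSpace I) p ϑ x))) ∧
      IsProbabilityMeasure (ScoreMartingale.modelLaw
        (ScoreMartingale.extendedDensity (ScoreMartingale.paramSpace I) p) ν ϑ)) ∧
    (∀ ϑ ∈ ScoreMartingale.paramSpace I,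
      ScoreMartingale.extendedDensity (ScoreMartingale.paramSpace I) p ϑ = p ϑ) ∧
    -- the parameters converge almost surely to a random vector
    ∃ θlim : Ω → Fin d → ℝ, Measurable θlim ∧
      (∀ᵐ ω ∂μ, θlim ω ∈ closure (ScoreMartingale.paramSpace I)) ∧
      (∀ᵐ ω ∂μ, Tendsto (fun m => θ m ω) atTop (𝓝 (θlim ω))) ∧
      -- their laws converge weakly
      TendstoInDistribution (fun j => θ (n + j)) atTop θlim (fun _ => μ) μ ∧
      -- the imputed observations are asymptotically exchangeable
      ∃ (Ω' : Type u) (_ : MeasurableSpace Ω') (P : Measure Ω') (_ : IsProbabilityMeasure P)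
        (ϑ : Ω' → Fin d → ℝ) (Z : ℕ → Ω' → S),
        Measurable ϑ ∧ (∀ i, Measurable (Z i)) ∧
        P.map ϑ = μ.map θlim ∧
        ScoreMartingale.CondIID P
          (ScoreMartingale.modelLaw
            (ScoreMartingale.extendedDensity (ScoreMartingale.paramSpace I) p) ν) ϑ Z ∧
        ScoreMartingale.Exchangeable P Z ∧
        TendstoInDistribution (fun j ω i => X (n + j + 1 + i) ω) atTop (fun ω i => Z i ω)
          (fun _ => μ) P := by
  open ScoreMartingale in
  refine ⟨fun ϑ hϑ => ⟨hp.tendsto_extendedDensity hϑ, hp.isProbabilityMeasure_extended hϑ⟩,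
    fun ϑ hϑ => hp.extendedDensity_eq hϑ, ?_⟩
  have hne : (paramSpace I).Nonempty := by
    obtain ⟨ω, hω⟩ := (hX.mem_paramSpace n le_rfl).exists
    exact ⟨_, hω⟩
  obtain ⟨κ, hκM, hκ⟩ := hp.exists_kernel hne
  have hκΘ : ∀ θ ∈ paramSpace I, κ θ = modelLaw p ν θ := fun θ hθ => by
    rw [hκ θ (subset_closure hθ), hp.modelLaw_extended hθ]
  -- Time is shifted by `n`, so that the abstract results apply from index 0.
  let 𝒢 : Filtration ℕ mΩ :=
    ⟨fun j => ℱ (n + j), fun i j hij => ℱ.mono (Nat.add_le_add_left hij n), fun j => ℱ.le _⟩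
  have hTm : ∀ j, Measurable[𝒢 j] (θ (n + j)) := fun j => hX.measurable_param _ (by omega)
  have hYm : ∀ j, Measurable[𝒢 (j + 1)] (X (n + j + 1)) := fun j =>
    hX.measurable_obs (n + j) (by omega)
  have hTm' : ∀ j, Measurable (θ (n + j)) := fun j => (hTm j).mono (𝒢.le j) le_rfl
  have hYm' : ∀ j, Measurable (X (n + j + 1)) := fun j => (hYm j).mono (𝒢.le _) le_rfl
  have hmem : ∀ᵐ ω ∂μ, ∀ j, θ (n + j) ω ∈ paramSpace I :=
    ae_all_iff.2 fun j => hX.mem_paramSpace _ (by omega)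
  have hs : ∀ j, ∀ B, MeasurableSet B →
      μ[(X (n + j + 1) ⁻¹' B).indicator (fun _ => (1 : ℝ)) | 𝒢 j]
        =ᵐ[μ] fun ω => (κ (θ (n + j) ω)).real B := fun j B hB => by
    filter_upwards [hX.sampling (n + j) (by omega) B hB, hmem] with ω h1 h2
    rw [hκΘ _ (h2 j), ← h1]
  obtain ⟨θlim, hθm, hθl⟩ := measurable_limit_of_tendsto_metrizable_ae
    (fun j => (hTm' j).aemeasurable)
    (IsScoreScheme.ae_exists_tendsto hp hI hκΘ hε hX (𝒢 := 𝒢) (fun j => rfl) hs)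
  have hcl : ∀ᵐ ω ∂μ, θlim ω ∈ closure (paramSpace I) := by
    filter_upwards [hθl, hmem] with ω h1 h2
    exact mem_closure_of_tendsto h1 (Eventually.of_forall h2)
  have hlim : ∀ B, MeasurableSet B → ∀ᵐ ω ∂μ,
      Tendsto (fun j => (κ (θ (n + j) ω)).real B) atTop (𝓝 ((κ (θlim ω)).real B)) := by
    intro B hB
    filter_upwards [hθl, hmem, hcl] with ω h1 h2 h3
    -- The path stays in `Θ` while its limit may lie on the boundary; setwise convergence at points
    -- of the closure covers both cases.
    have h4 := (hp.tendsto_modelLaw h3 hB).comp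
      (tendsto_nhdsWithin_iff.2 ⟨h1, Eventually.of_forall h2⟩)
    rw [← hκ _ h3] at h4
    refine ((ENNReal.tendsto_toReal (measure_ne_top _ _)).comp h4).congr fun j => ?_
    simp only [Function.comp_apply, Measure.real, hκΘ _ (h2 j)]
  have hπ : IsProbabilityMeasure (μ.map θlim) :=
    Measure.isProbabilityMeasure_map hθm.aemeasurable
  -- The limit sequence lives on the space of pairs of a parameter and a sequence: the parameter has
  -- the law of `θlim`, and given it the sequence is i.i.d. from `κ`.
  refine ⟨θlim, hθm, hcl, ?_, tendstoInDistribution_of_ae_tendsto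
    (fun j => (hTm' j).aemeasurable) hθm.aemeasurable hθl,
    (Fin d → ℝ) × (ℕ → S), inferInstance, (μ.map θlim) ⊗ₘ iidKernel κ, inferInstance,
    Prod.fst, fun i ω => ω.2 i, measurable_fst,
    fun i => (measurable_pi_apply i).comp measurable_snd, Measure.fst_compProd _ _, ?_,
    exchangeable_compProd_iidKernel κ _, ?_⟩
  · filter_upwards [hθl] with ω h
    refine (tendsto_add_atTop_iff_nat n).1 (h.congr fun j => ?_)
    rw [add_comm]
  · refine (condIID_compProd_iidKernel κ _).congr ?_
    -- `κ` is the extended model only on the closure, which carries the law of `θlim`.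
    have h1 : ∀ᵐ ϑ ∂(((μ.map θlim) ⊗ₘ iidKernel κ).map Prod.fst), ϑ ∈ closure (paramSpace I) := by
      have h2 : ((μ.map θlim) ⊗ₘ iidKernel κ).map Prod.fst = μ.map θlim :=
        Measure.fst_compProd _ _
      rw [h2]
      exact (ae_map_iff hθm.aemeasurable isClosed_closure.measurableSet).2 hcl
    filter_upwards [ae_of_ae_map measurable_fst.aemeasurable h1] with ω h
    exact hκ _ h
  · refine tendstoInDistribution_of_tendsto_rectangles (fun j => ?_) measurable_snd ?_
    · exact measurable_pi_lambda _ fun i => by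
        rw [show n + j + 1 + i = n + (j + i) + 1 by omega]
        exact hYm' _
    · intro A hA k
      have h1 := tendsto_measureReal_iInter hTm hYm hs hlim hA k
      have h2 : ((μ.map θlim) ⊗ₘ iidKernel κ) (Prod.snd ⁻¹' Set.pi (Finset.range k) A)
          = ENNReal.ofReal (∫ ω, ∏ i ∈ Finset.range k, (κ (θlim ω)).real (A i) ∂μ) := by
        rw [compProd_iidKernel_preimage_pi κ _ hA,
          ← integral_map (f := fun ϑ => ∏ i ∈ Finset.range k, (κ ϑ).real (A i))
            hθm.aemeasurable
            (integrable_prod_measureReal κ _ measurable_id hA).aestronglyMeasurable,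
          ← setIntegral_univ, setIntegral_prod_measureReal κ _ _ hA, Measure.restrict_univ,
          ENNReal.ofReal_toReal]
        rw [← compProd_iidKernel_preimage_pi κ _ hA]
        exact measure_ne_top _ _
      have h3 := ENNReal.tendsto_ofReal h1
      rw [← h2] at h3
      refine h3.congr fun j => ?_
      rw [ofReal_measureReal]
      congr 1
      ext ω
      simp only [Set.mem_iInter, Set.mem_preimage, Set.mem_pi, Finset.mem_coe]
      refine forall₂_congr fun i _ => ?_
      rw [show n + j + 1 + i = n + (j + i) + 1 by omega]
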